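/- Let $0\le\alpha<1$. Let $\rho\in C^\infty(\mathbb{R})$ be a non-negative function with $\rho(\xi)=0$ for $\xi\le -1$, $\rho(\xi)=1$ for $\xi\ge 1$, and $\rho(\xi)^2+\rho(-\xi)^2=1$ for all $\xi\in\mathbb{R}$. For an interval $I=[a,a')$ with cutoff radii $\varepsilon,\varepsilon'>0$ at $a$ and $a'$, and for $n\in\mathbb{N}_0$, the brushlet $w_{n,I}$ is the function on $\mathbb{R}$ with Fourier transform $$\hat w_{n,I}(\xi)=\sqrt{\tfrac{2}{|I|}}\;\rho\Bigl(\frac{\xi-a}{\varepsilon}\Bigr)\rho\Bigl(\frac{a'-\xi}{\varepsilon'}\Bigr)\cos\Bigl(\pi\bigl(n+\tfrac12\bigr)\frac{\xi-a}{|I|}\Bigr),$$ where $\hat f(\xi)=(2\pi)^{-1/2}\int_{\mathbb{R}} f(x)e^{-ix\xi}\,dx$. Put $R_j=j^{1/(1-\alpha)}$ for integers $j\ge 1$ and $R_j=|j|^{-1/(1-\alpha)}$ for integers $j\le -1$, and $A_j=[-R_j,R_j)$; thus $A_{-1}=A_1$. For each integer $j\notin\{0,1\}$, let $N_j\ge 1$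 be an integer and divide $A_j$ into $2N_j+1$ intervals $I_{j,n}=[r_{j,n},r_{j,n+1})$, $-N_j\le n\le N_j$, with $r_{j,-N_j}<\dots<r_{j,N_j+1}$, such that $$I_{j,-N_j}=[-R_j,-R_{j-1}),\qquad I_{j,N_j}=[R_{j-1},R_j).$$ To every endpoint $t$ of one of these intervals assign a cutoff radius $\varepsilon(t)>0$, such that $\varepsilon(r_{j,n})+\varepsilon(r_{j,n+1})\le|I_{j,n}|$ for all $j$ and $n$, and let the interval $I_{j,n}$ have the cutoff radii $\varepsilon(r_{j,n})$ and $\varepsilon(r_{j,n+1})$ at its left and right endpoint. For $j\notin\{0,1\}$ let $\mathcal{A}_j$ be the set of the rectangles $I_{j,m}\times I_{j,n}$ with $-N_j\le m,n\le N_j$ and $\max(|m|,|n|)=N_j$, and put $\mathcal{A}_0=\mathcal{A}_1=\emptyset$. For $Q=I\times J\in\mathcal{A}_j$ and $n=(n_1,n_2)\in\mathbb{N}_0^2$ put $w_{n,Q}=w_{n_1,I}\otimes w_{n_2,J}$. Then the system $\{w_{n,Q}: n\in\mathbb{N}_0^2,\ Q\in\mathcal{A}_j,\ j\in\mathbb{Z}\}$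 is an orthonormal basis of $L_2(\mathbb{R}^2)$. -/

import Mathlib

open MeasureTheory
open scoped ContDiff

noncomputable section

namespace Brushlet

/-- A non-negative smooth ramp function. -/
structure IsRamp (ρ : ℝ → ℝ) : Prop where
  smooth : ContDiff ℝ ∞ ρ
  nonneg : ∀ ξ, 0 ≤ ρ ξ
  eq_zero : ∀ ξ, ξ ≤ -1 → ρ ξ = 0
  eq_one : ∀ ξ, 1 ≤ ξ → ρ ξ = 1
  sq_add_sq : ∀ ξ, ρ ξ ^ 2 + ρ (-ξ) ^ 2 = 1

/-- The bell function of the interval `[a, b)` with cutoff radii `ε` at `a` and `ε'` at `b`. -/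
def bell (ρ : ℝ → ℝ) (a b ε ε' : ℝ) (ξ : ℝ) : ℝ :=
  ρ ((ξ - a) / ε) * ρ ((b - ξ) / ε')

/-- The local cosine function of `[a, b)`, which is the Fourier transform of the brushlet. -/
def brushletHat (ρ : ℝ → ℝ) (a b ε ε' : ℝ) (n : ℕ) (ξ : ℝ) : ℝ :=
  √(2 / (b - a)) * bell ρ a b ε ε' ξ *
    Real.cos (Real.pi * ((n : ℝ) + 1 / 2) * ((ξ - a) / (b - a)))

/-- The univariate brushlet: the inverse Fourier transform of `brushletHat`, for the unitary
normalization `f̂(ξ) = (2π)^{-1/2} ∫ f(x) e^{-ixξ} dx`. -/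
def brushlet (ρ : ℝ → ℝ) (a b ε ε' : ℝ) (n : ℕ) (x : ℝ) : ℂ :=
  ((√(2 * Real.pi))⁻¹ : ℝ) *
    ∫ ξ : ℝ, Complex.exp (Complex.I * x * ξ) * (brushletHat ρ a b ε ε' n ξ : ℂ)

/-- The positive endpoint of the interval `A_j`: it is `j^{1/(1-α)}` for `j ≥ 1` and
`|j|^{-1/(1-α)}` for `j ≤ -1`. -/
def radius (α : ℝ) (j : ℤ) : ℝ :=
  if 0 < j then (j : ℝ) ^ (1 / (1 - α)) else |(j : ℝ)| ^ (-(1 / (1 - α)))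

/-- The levels `j` that carry a non-empty annulus. The annulus of level `j` fills the region between
the squares `A_{j-1} × A_{j-1}` and `A_j × A_j`. There is none at level `0`, and none at level `1`
because the annuli of the negative levels already fill `A_{-1} × A_{-1} = A_1 × A_1`. -/
def IsLevel (j : ℤ) : Prop := j ≤ -1 ∨ 2 ≤ j

/-- The data of a separable rectangular `α`-covering with compatible endpoints and cutoff radii.
At each level `j` the interval `A_j` is divided into the `2 N_j + 1` intervals
`I_{j,n} = [r_{j,n}, r_{j,n+1})`, `-N_j ≤ n ≤ N_j`, the two outermost of which are the two
components of `A_j \ A_{j-1}`. The cutoff radius at an endpoint `t` is `ε t`; hence intervals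
that share an endpoint have the same cutoff radius there. -/
structure AlphaCovering (α : ℝ) where
  N : ℤ → ℕ
  r : ℤ → ℤ → ℝ
  ε : ℝ → ℝ
  one_le_N : ∀ j, IsLevel j → 1 ≤ N j
  r_lt : ∀ j, IsLevel j → ∀ n ∈ Set.Icc (-(N j : ℤ)) (N j), r j n < r j (n + 1)
  r_first : ∀ j, IsLevel j → r j (-(N j : ℤ)) = -radius α j
  r_second : ∀ j, IsLevel j → r j (-(N j : ℤ) + 1) = -radius α (j - 1)
  r_penultimate : ∀ j, IsLevel j → r j (N j) = radius α (j - 1)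
  r_last : ∀ j, IsLevel j → r j ((N j : ℤ) + 1) = radius α j
  ε_pos : ∀ j, IsLevel j → ∀ n ∈ Set.Icc (-(N j : ℤ)) ((N j : ℤ) + 1), 0 < ε (r j n)
  ε_add_le : ∀ j, IsLevel j → ∀ n ∈ Set.Icc (-(N j : ℤ)) (N j),
    ε (r j n) + ε (r j (n + 1)) ≤ r j (n + 1) - r j n

namespace AlphaCovering

variable {α : ℝ} (C : AlphaCovering α)

/-- Left side of the annulus; a pair `(m, n)` stands for the rectangle `I_{j,m} × I_{j,n}`. -/
def annulusL (j : ℤ) : Set (ℤ × ℤ) :=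
  {q | q.1 = -(C.N j : ℤ) ∧ -(C.N j : ℤ) ≤ q.2 ∧ q.2 ≤ C.N j}

/-- Right side of the annulus. -/
def annulusR (j : ℤ) : Set (ℤ × ℤ) :=
  {q | q.1 = (C.N j : ℤ) ∧ -(C.N j : ℤ) ≤ q.2 ∧ q.2 ≤ C.N j}

/-- Top of the annulus. -/
def annulusT (j : ℤ) : Set (ℤ × ℤ) :=
  {q | q.2 = (C.N j : ℤ) ∧ -(C.N j : ℤ) < q.1 ∧ q.1 < C.N j}

/-- Bottom of the annulus. -/
def annulusB (j : ℤ) : Set (ℤ × ℤ) :=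
  {q | q.2 = -(C.N j : ℤ) ∧ -(C.N j : ℤ) < q.1 ∧ q.1 < C.N j}

/-- The rectangular annulus `𝒜_j`, empty if `j` is not a level. -/
def annulus (j : ℤ) : Set (ℤ × ℤ) :=
  {q | IsLevel j ∧ q ∈ C.annulusL j ∪ C.annulusR j ∪ C.annulusT j ∪ C.annulusB j}

/-- The univariate brushlet `w_{k,I}` of the interval `I = I_{j,n}`. -/
def univariate (ρ : ℝ → ℝ) (j n : ℤ) (k : ℕ) : ℝ → ℂ :=
  brushlet ρ (C.r j n) (C.r j (n + 1)) (C.ε (C.r j n)) (C.ε (C.r j (n + 1))) k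

/-- The bivariate brushlet `w_{k,Q} = w_{k₁,I} ⊗ w_{k₂,J}` of the rectangle
`Q = I × J = I_{j,q₁} × I_{j,q₂}`. -/
def bivariate (ρ : ℝ → ℝ) (j : ℤ) (q : ℤ × ℤ) (k : ℕ × ℕ) (x : ℝ × ℝ) : ℂ :=
  C.univariate ρ j q.1 k.1 x.1 * C.univariate ρ j q.2 k.2 x.2

end AlphaCovering

end Brushlet

end

noncomputable section

namespace Brushlet

open scoped ComplexInnerProductSpace

/-! ### Half-line spaces of smooth local symmetry -/

/-! On the Fourier side, a point `t` splits every function into a cutoff times an even function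
about `t` and the mirrored cutoff times an odd one. The two resulting spaces are orthogonal
complements (`IsRamp.orthogonal_rightSpace`). The right spaces E(t) decrease from one endpoint of an
interval of the covering to the next, because the cutoff zones at its ends do not overlap
(`IsRamp.rightSpace_le`). So [a, b) owns the space E(a) ⊓ E(b)ᗮ, with projection P_a - P_b. Folding
at a and b reduces this space to functions on (a, b) and the local cosines to half-integer cosines;
hence the local cosines are orthonormal and total in it (`Admissible.orthonormal_lpHat`,
`Admissible.eq_zero_of_inner_lpHat_eq_zero`).

In the plane, rectangles of one level differ in a factor, and a rectangle of a higher level has a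
factor that is an outermost interval, hence outside the smaller square; this gives orthogonality
(`LocalBases.orthonormal_tensor`). For completeness put D_j = P_{-R_j} - P_{R_j}, the projection
belonging to A_j, and let h be orthogonal to the system. The form ⟪h, D_j f ⊗ D_j g⟫ is the sum of
its parts on the rectangles of level j. The annulus contributes nothing, and the interior rectangles
add up to the form of level j - 1 (`LocalBases.inner_square_step`). So the form does not depend on
j. Since D_j tends to the identity as j → ∞ and to 0 as j → -∞, h is orthogonal to all tensor
products and vanishes. The inverse Fourier transform in both variables is unitary and carries the
local cosines to the brushlets. -/

lemma ae_reflect (t : ℝ) {p : ℝ → Prop} (h : ∀ᵐ ξ : ℝ, p ξ) : ∀ᵐ ξ : ℝ, p (2 * t - ξ) :=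
  (Measure.measurePreserving_sub_left volume (2 * t)).quasiMeasurePreserving.ae h

/-- The functions in `L²(ℝ)` that belong to `[t, ∞)` smoothly: the cutoff at `t` times an even
function about `t`. -/
def rightSpace (ρ : ℝ → ℝ) (t ε : ℝ) : Submodule ℂ (Lp ℂ 2 (volume : Measure ℝ)) where
  carrier := {f | ∀ᵐ ξ : ℝ, (ρ ((t - ξ) / ε) : ℂ) * f ξ = ρ ((ξ - t) / ε) * f (2 * t - ξ)}
  zero_mem' := by
    have h := Lp.coeFn_zero ℂ 2 (volume : Measure ℝ)
    rw [Set.mem_ofPred_eq]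
    filter_upwards [h, ae_reflect t h] with ξ h1 h2
    rw [h1, h2]; simp
  add_mem' := by
    intro f g hf hg
    have h := Lp.coeFn_add f g
    rw [Set.mem_ofPred_eq] at hf hg ⊢
    filter_upwards [h, ae_reflect t h, hf, hg] with ξ h1 h2 h3 h4
    rw [h1, h2]
    simp only [Pi.add_apply, mul_add, h3, h4]
  smul_mem' := by
    intro c f hf
    have h := Lp.coeFn_smul c f
    rw [Set.mem_ofPred_eq] at hf ⊢
    filter_upwards [h, ae_reflect t h, hf] with ξ h1 h2 h3
    rw [h1, h2]
    simp only [Pi.smul_apply, smul_eq_mul, mul_left_comm _ c, h3]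

/-- The functions in `L²(ℝ)` that belong to `(-∞, t)` smoothly: the cutoff at `t` times an odd
function about `t`. -/
def leftSpace (ρ : ℝ → ℝ) (t ε : ℝ) : Submodule ℂ (Lp ℂ 2 (volume : Measure ℝ)) where
  carrier := {f | ∀ᵐ ξ : ℝ, (ρ ((ξ - t) / ε) : ℂ) * f ξ = -(ρ ((t - ξ) / ε) * f (2 * t - ξ))}
  zero_mem' := by
    have h := Lp.coeFn_zero ℂ 2 (volume : Measure ℝ)
    rw [Set.mem_ofPred_eq]
    filter_upwards [h, ae_reflect t h] with ξ h1 h2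
    rw [h1, h2]; simp
  add_mem' := by
    intro f g hf hg
    have h := Lp.coeFn_add f g
    rw [Set.mem_ofPred_eq] at hf hg ⊢
    filter_upwards [h, ae_reflect t h, hf, hg] with ξ h1 h2 h3 h4
    rw [h1, h2]
    simp only [Pi.add_apply, mul_add, h3, h4, neg_add]
  smul_mem' := by
    intro c f hf
    have h := Lp.coeFn_smul c f
    rw [Set.mem_ofPred_eq] at hf ⊢
    filter_upwards [h, ae_reflect t h, hf] with ξ h1 h2 h3
    rw [h1, h2]
    simp only [Pi.smul_apply, smul_eq_mul, mul_left_comm _ c, h3, mul_neg]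

lemma mem_rightSpace {ρ : ℝ → ℝ} {t ε : ℝ} {f : Lp ℂ 2 (volume : Measure ℝ)} :
    f ∈ rightSpace ρ t ε ↔
      ∀ᵐ ξ : ℝ, (ρ ((t - ξ) / ε) : ℂ) * f ξ = ρ ((ξ - t) / ε) * f (2 * t - ξ) := Iff.rfl

lemma mem_leftSpace {ρ : ℝ → ℝ} {t ε : ℝ} {f : Lp ℂ 2 (volume : Measure ℝ)} :
    f ∈ leftSpace ρ t ε ↔
      ∀ᵐ ξ : ℝ, (ρ ((ξ - t) / ε) : ℂ) * f ξ = -(ρ ((t - ξ) / ε) * f (2 * t - ξ)) := Iff.rfl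

namespace IsRamp

variable {ρ : ℝ → ℝ} (hρ : IsRamp ρ)
include hρ

lemma sq_add_sq_cut (t ε ξ : ℝ) : ρ ((ξ - t) / ε) ^ 2 + ρ ((t - ξ) / ε) ^ 2 = 1 := by
  have h := hρ.sq_add_sq ((ξ - t) / ε)
  rwa [← neg_div, neg_sub] at h

lemma sq_add_sq_cut_complex (t ε ξ : ℝ) :
    (ρ ((ξ - t) / ε) : ℂ) ^ 2 + (ρ ((t - ξ) / ε) : ℂ) ^ 2 = 1 := by
  exact_mod_cast hρ.sq_add_sq_cut t ε ξ

lemma le_one (x : ℝ) : ρ x ≤ 1 := by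
  nlinarith [hρ.sq_add_sq x, hρ.nonneg x, sq_nonneg (ρ (-x))]

lemma continuous : Continuous ρ := hρ.smooth.continuous

lemma cut_eq_zero {t ε ξ : ℝ} (hε : 0 < ε) (h : ξ ≤ t - ε) : ρ ((ξ - t) / ε) = 0 :=
  hρ.eq_zero _ (by rw [div_le_iff₀ hε]; linarith)

lemma cut_eq_one {t ε ξ : ℝ} (hε : 0 < ε) (h : t + ε ≤ ξ) : ρ ((ξ - t) / ε) = 1 :=
  hρ.eq_one _ (by rw [le_div_iff₀ hε]; linarith)

lemma cut_eq_zero' {t ε ξ : ℝ} (hε : 0 < ε) (h : t + ε ≤ ξ) : ρ ((t - ξ) / ε) = 0 :=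
  hρ.eq_zero _ (by rw [div_le_iff₀ hε]; linarith)

lemma cut_eq_one' {t ε ξ : ℝ} (hε : 0 < ε) (h : ξ ≤ t - ε) : ρ ((t - ξ) / ε) = 1 :=
  hρ.eq_one _ (by rw [le_div_iff₀ hε]; linarith)

lemma ae_eq_zero_of_mem_rightSpace {t ε : ℝ} (hε : 0 < ε) {f : Lp ℂ 2 (volume : Measure ℝ)}
    (hf : f ∈ rightSpace ρ t ε) : ∀ᵐ ξ : ℝ, ξ ≤ t - ε → f ξ = 0 := by
  filter_upwards [hf] with ξ h hξ
  simpa [hρ.cut_eq_zero hε hξ, hρ.cut_eq_one' hε hξ] using h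

lemma ae_eq_zero_of_mem_leftSpace {t ε : ℝ} (hε : 0 < ε) {f : Lp ℂ 2 (volume : Measure ℝ)}
    (hf : f ∈ leftSpace ρ t ε) : ∀ᵐ ξ : ℝ, t + ε ≤ ξ → f ξ = 0 := by
  filter_upwards [hf] with ξ h hξ
  simpa [hρ.cut_eq_zero' hε hξ, hρ.cut_eq_one hε hξ] using h

/-- A function of the smaller space vanishes up to `s - δ`, thus on the whole cutoff zone of `t`,
where the symmetry condition at `t` becomes trivial. -/
lemma rightSpace_le {t ε s δ : ℝ} (hε : 0 < ε) (hδ : 0 < δ) (h : t + ε ≤ s - δ) :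
    rightSpace ρ s δ ≤ rightSpace ρ t ε := by
  intro f hf
  have h0 := hρ.ae_eq_zero_of_mem_rightSpace hδ hf
  filter_upwards [h0, ae_reflect t h0] with ξ h1 h2
  rcases le_total (t + ε) ξ with h3 | h3
  · rw [hρ.cut_eq_zero' hε h3, h2 (by linarith)]; simp
  · rw [h1 (by linarith)]
    rcases le_total ξ (t - ε) with h4 | h4
    · rw [hρ.cut_eq_zero hε h4]; simp
    · rw [h2 (by linarith)]; simp

/-- The product of the two cutoffs is even about `t`, so even times odd makes the pointwise inner
product change sign under reflection. Its integral equals its own negative. -/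
lemma inner_eq_zero {t ε : ℝ} {f g : Lp ℂ 2 (volume : Measure ℝ)}
    (hf : f ∈ rightSpace ρ t ε) (hg : g ∈ leftSpace ρ t ε) : ⟪f, g⟫ = 0 := by
  rw [L2.inner_def]
  have key : ∀ᵐ ξ : ℝ, ⟪f (2 * t - ξ), g (2 * t - ξ)⟫ = -⟪f ξ, g ξ⟫ := by
    filter_upwards [hf, hg] with ξ h1 h2
    have hc := hρ.sq_add_sq_cut_complex t ε ξ
    simp only [RCLike.inner_apply]
    set c : ℂ := (ρ ((ξ - t) / ε) : ℂ) with hcd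
    set d : ℂ := (ρ ((t - ξ) / ε) : ℂ) with hdd
    have k1 := congrArg (starRingEnd ℂ) h1
    simp only [map_mul, hcd, hdd, Complex.conj_ofReal] at k1
    rw [← hcd, ← hdd] at k1
    set x := (starRingEnd ℂ) (f ξ)
    set x' := (starRingEnd ℂ) (f (2 * t - ξ))
    linear_combination (-(g (2 * t - ξ) * x' + g ξ * x)) * hc + (c * x + d * x') * h2 +
      (d * g ξ - c * g (2 * t - ξ)) * k1
  have h1 : ∫ ξ : ℝ, ⟪f (2 * t - ξ), g (2 * t - ξ)⟫ = ∫ ξ : ℝ, ⟪f ξ, g ξ⟫ :=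
    integral_sub_left_eq_self (fun ξ => ⟪f ξ, g ξ⟫) volume (2 * t)
  rw [integral_congr_ae key, integral_neg] at h1
  exact self_eq_neg.mp h1.symm

lemma exists_mem_rightSpace_sub_mem_leftSpace (t ε : ℝ) (f : Lp ℂ 2 (volume : Measure ℝ)) :
    ∃ g ∈ rightSpace ρ t ε, f - g ∈ leftSpace ρ t ε := by
  have hc : Continuous fun ξ : ℝ => (ρ ((ξ - t) / ε) : ℂ) :=
    Complex.continuous_ofReal.comp (hρ.continuous.comp (by fun_prop))
  have hd : Continuous fun ξ : ℝ => (ρ ((t - ξ) / ε) : ℂ) :=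
    Complex.continuous_ofReal.comp (hρ.continuous.comp (by fun_prop))
  have bound : ∀ x : ℝ, ‖(ρ x : ℂ)‖ ≤ 1 := fun x => by
    rw [Complex.norm_real, Real.norm_of_nonneg (hρ.nonneg x)]
    exact hρ.le_one x
  have hf' : MemLp (fun ξ => f (2 * t - ξ)) 2 volume :=
    (Lp.memLp f).comp_measurePreserving (Measure.measurePreserving_sub_left volume (2 * t))
  have m1 : MemLp (fun ξ : ℝ => (ρ ((ξ - t) / ε) : ℂ) * f ξ) 2 volume :=
    (Lp.memLp f).of_le_mul (c := 1) (hc.aestronglyMeasurable.mul (Lp.memLp f).1)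
      (.of_forall fun ξ => by
        rw [norm_mul]; exact mul_le_mul_of_nonneg_right (bound _) (norm_nonneg _))
  have m2 : MemLp (fun ξ : ℝ => (ρ ((t - ξ) / ε) : ℂ) * f (2 * t - ξ)) 2 volume :=
    hf'.of_le_mul (c := 1) (hd.aestronglyMeasurable.mul hf'.1)
      (.of_forall fun ξ => by
        rw [norm_mul]; exact mul_le_mul_of_nonneg_right (bound _) (norm_nonneg _))
  -- With c, d the cutoff and its mirror image and f' the reflection of f, the right part is c (c f
  -- + d f'). The remainder is d (d f - c f') by c² + d² = 1, which is d times an odd function.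
  have m3 : MemLp (fun ξ : ℝ => (ρ ((ξ - t) / ε) : ℂ) * (ρ ((ξ - t) / ε) * f ξ +
      ρ ((t - ξ) / ε) * f (2 * t - ξ))) 2 volume :=
    (m1.add m2).of_le_mul (c := 1) (hc.aestronglyMeasurable.mul (m1.add m2).1)
      (.of_forall fun ξ => by
        rw [norm_mul]; exact mul_le_mul_of_nonneg_right (bound _) (norm_nonneg _))
  have e1 : ∀ ξ : ℝ, t - (2 * t - ξ) = ξ - t := fun ξ => by ring
  have e2 : ∀ ξ : ℝ, 2 * t - ξ - t = t - ξ := fun ξ => by ring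
  have e3 : ∀ ξ : ℝ, 2 * t - (2 * t - ξ) = ξ := fun ξ => by ring
  have hg := m3.coeFn_toLp
  refine ⟨m3.toLp _, ?_, ?_⟩
  · rw [mem_rightSpace]
    filter_upwards [hg, ae_reflect t hg] with ξ h1 h2
    rw [h1, h2, e1, e2, e3]
    ring
  · rw [mem_leftSpace]
    have hs := Lp.coeFn_sub f (m3.toLp _)
    filter_upwards [hg, ae_reflect t hg, hs, ae_reflect t hs] with ξ h1 h2 h3 h4
    rw [h3, h4, Pi.sub_apply, Pi.sub_apply, h1, h2, e1, e2, e3]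
    have hc := hρ.sq_add_sq_cut_complex t ε ξ
    linear_combination (-(ρ ((ξ - t) / ε) * f ξ +
      ρ ((t - ξ) / ε) * f (2 * t - ξ))) * hc

lemma orthogonal_rightSpace (t ε : ℝ) : (rightSpace ρ t ε)ᗮ = leftSpace ρ t ε := by
  apply le_antisymm
  · intro f hf
    obtain ⟨g, hg, hfg⟩ := hρ.exists_mem_rightSpace_sub_mem_leftSpace t ε f
    have h1 : ⟪g, f⟫ = 0 := (Submodule.mem_orthogonal _ _).1 hf g hg
    have h2 : ⟪g, f - g⟫ = 0 := hρ.inner_eq_zero hg hfg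
    rw [inner_sub_right, h1, zero_sub, neg_eq_zero, inner_self_eq_zero] at h2
    simpa [h2] using hfg
  · intro f hf
    exact (Submodule.mem_orthogonal _ _).2 fun g hg => hρ.inner_eq_zero hg hf

lemma hasOrthogonalProjection_rightSpace (t ε : ℝ) :
    (rightSpace ρ t ε).HasOrthogonalProjection where
  exists_orthogonal f := by
    obtain ⟨g, hg, hfg⟩ := hρ.exists_mem_rightSpace_sub_mem_leftSpace t ε f
    exact ⟨g, hg, by rwa [hρ.orthogonal_rightSpace]⟩

end IsRamp

/-! ### Half-integer cosines on an interval -/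

/-- The cosine of half-integer frequency on `[a, b)`, even about `a` and odd about `b`. -/
def halfCos (a b : ℝ) (k : ℕ) (ξ : ℝ) : ℝ :=
  Real.cos (Real.pi * ((k : ℝ) + 1 / 2) * ((ξ - a) / (b - a)))

lemma continuous_halfCos (a b : ℝ) (k : ℕ) : Continuous (halfCos a b k) := by
  unfold halfCos; fun_prop

lemma abs_halfCos_le_one (a b : ℝ) (k : ℕ) (ξ : ℝ) : |halfCos a b k ξ| ≤ 1 :=
  Real.abs_cos_le_one _

lemma halfCos_reflect_left (a b : ℝ) (k : ℕ) (ξ : ℝ) :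
    halfCos a b k (2 * a - ξ) = halfCos a b k ξ := by
  unfold halfCos
  rw [← Real.cos_neg]
  congr 1
  ring

lemma halfCos_reflect_right {a b : ℝ} (hab : a < b) (k : ℕ) (ξ : ℝ) :
    halfCos a b k (2 * b - ξ) = -halfCos a b k ξ := by
  unfold halfCos
  have h : b - a ≠ 0 := (sub_pos.2 hab).ne'
  have e : Real.pi * ((k : ℝ) + 1 / 2) * ((2 * b - ξ - a) / (b - a)) =
      Real.pi - Real.pi * ((k : ℝ) + 1 / 2) * ((ξ - a) / (b - a)) + k * (2 * Real.pi) := by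
    field_simp
    ring
  rw [e, Real.cos_add_nat_mul_two_pi, Real.cos_pi_sub]

lemma integral_cos_int_mul {a b : ℝ} (hab : a < b) {m : ℤ} (hm : m ≠ 0) :
    ∫ ξ in a..b, Real.cos (m * (Real.pi * ((ξ - a) / (b - a)))) = 0 := by
  have h : b - a ≠ 0 := (sub_pos.2 hab).ne'
  have hc : (m : ℝ) * Real.pi / (b - a) ≠ 0 :=
    div_ne_zero (mul_ne_zero (by exact_mod_cast hm) Real.pi_ne_zero) h
  have e : ∀ ξ : ℝ, (m : ℝ) * (Real.pi * ((ξ - a) / (b - a))) =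
      m * Real.pi / (b - a) * ξ - m * Real.pi / (b - a) * a := fun ξ => by ring
  simp_rw [e]
  rw [intervalIntegral.integral_comp_mul_sub _ hc, integral_cos, ← mul_sub,
    div_mul_cancel₀ _ h, sub_self, Real.sin_int_mul_pi, Real.sin_zero]
  simp

/-- The product formula yields the integer frequencies k - l and k + l + 1; the second is never
zero. -/
lemma integral_halfCos_mul_halfCos {a b : ℝ} (hab : a < b) (k l : ℕ) :
    ∫ ξ in a..b, halfCos a b k ξ * halfCos a b l ξ = if k = l then (b - a) / 2 else 0 := by
  have e : ∀ ξ : ℝ, halfCos a b k ξ * halfCos a b l ξ =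
      (1 / 2) * (Real.cos (((k - l : ℤ) : ℝ) * (Real.pi * ((ξ - a) / (b - a)))) +
        Real.cos (((k + l + 1 : ℤ) : ℝ) * (Real.pi * ((ξ - a) / (b - a))))) := by
    intro ξ
    unfold halfCos
    have h1 : (((k - l : ℤ) : ℝ) * (Real.pi * ((ξ - a) / (b - a)))) =
      Real.pi * ((k : ℝ) + 1 / 2) * ((ξ - a) / (b - a)) -
        Real.pi * ((l : ℝ) + 1 / 2) * ((ξ - a) / (b - a)) := by push_cast; ring
    have h2 : (((k + l + 1 : ℤ) : ℝ) * (Real.pi * ((ξ - a) / (b - a)))) =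
      Real.pi * ((k : ℝ) + 1 / 2) * ((ξ - a) / (b - a)) +
        Real.pi * ((l : ℝ) + 1 / 2) * ((ξ - a) / (b - a)) := by push_cast; ring
    rw [h1, h2, Real.cos_sub, Real.cos_add]
    ring
  simp_rw [e]
  rw [intervalIntegral.integral_const_mul, intervalIntegral.integral_add
    (Continuous.intervalIntegrable (by fun_prop) _ _)
    (Continuous.intervalIntegrable (by fun_prop) _ _),
    integral_cos_int_mul hab (m := (k + l + 1 : ℤ)) (by omega)]
  split_ifs with h
  · subst h
    simp
    ring
  · rw [integral_cos_int_mul hab (by omega)]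
    simp

/-- Multiplication by cos θ turns a half-integer cosine into the mean of its two neighbours, so
orthogonality to the whole family survives. -/
lemma integral_cos_pow_mul_halfCos_eq_zero {a b : ℝ} {F : ℝ → ℂ}
    (hF : IntervalIntegrable F volume a b)
    (h : ∀ k, ∫ ξ in a..b, F ξ * (halfCos a b k ξ : ℂ) = 0) (m k : ℕ) :
    ∫ ξ in a..b, F ξ * (halfCos a b k ξ * Real.cos (Real.pi * ((ξ - a) / (b - a))) ^ m : ℝ) = 0 := by
  induction m generalizing k with
  | zero => simpa using h k
  | succ m ih =>
    have hi : ∀ k, IntervalIntegrable (fun ξ => F ξ *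
        (halfCos a b k ξ * Real.cos (Real.pi * ((ξ - a) / (b - a))) ^ m : ℝ)) volume a b := fun k =>
      hF.mul_continuousOn (Complex.continuous_ofReal.comp
        ((continuous_halfCos a b k).mul (by fun_prop))).continuousOn
    -- The truncated `k - 1` is right even for `k = 0`: the neighbour of frequency -1/2 is the
    -- cosine of frequency 1/2 itself.
    have step : ∀ k : ℕ, ∀ ξ : ℝ,
        halfCos a b k ξ * Real.cos (Real.pi * ((ξ - a) / (b - a))) =
          (1 / 2) * (halfCos a b (k + 1) ξ + halfCos a b (k - 1) ξ) := by
      intro k ξ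
      set θ := Real.pi * ((ξ - a) / (b - a)) with hθ
      have h1 : ∀ l : ℕ, halfCos a b l ξ = Real.cos ((l + 1 / 2) * θ) := fun l => by
        rw [halfCos, hθ]; congr 1; ring
      have h2 : halfCos a b (k + 1) ξ = Real.cos ((k + 1 / 2) * θ + θ) := by
        rw [h1]; congr 1; push_cast; ring
      have h3 : halfCos a b (k - 1) ξ = Real.cos ((k + 1 / 2) * θ - θ) := by
        rw [h1]
        rcases k with _ | k
        · rw [← Real.cos_neg]; congr 1; simp; ring
        · congr 1; simp; ring
      rw [h1, h2, h3, Real.cos_add, Real.cos_sub]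
      ring
    have e : ∀ ξ : ℝ, F ξ *
        (halfCos a b k ξ * Real.cos (Real.pi * ((ξ - a) / (b - a))) ^ (m + 1) : ℝ) =
        (1 / 2 : ℂ) *
          (F ξ * (halfCos a b (k + 1) ξ * Real.cos (Real.pi * ((ξ - a) / (b - a))) ^ m : ℝ) +
          F ξ * (halfCos a b (k - 1) ξ * Real.cos (Real.pi * ((ξ - a) / (b - a))) ^ m : ℝ)) := by
      intro ξ
      rw [pow_succ', ← mul_assoc, step]
      push_cast
      ring
    simp_rw [e]
    rw [intervalIntegral.integral_const_mul, intervalIntegral.integral_add (hi _) (hi _), ih, ih]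
    simp

lemma integral_polynomial_cos_eq_zero {a b : ℝ} {F : ℝ → ℂ}
    (hF : IntervalIntegrable F volume a b)
    (h : ∀ k, ∫ ξ in a..b, F ξ * (halfCos a b k ξ : ℂ) = 0) (p : Polynomial ℝ) :
    ∫ ξ in a..b, F ξ *
      (halfCos a b 0 ξ * p.eval (Real.cos (Real.pi * ((ξ - a) / (b - a)))) : ℝ) = 0 := by
  have hi : ∀ p : Polynomial ℝ, IntervalIntegrable (fun ξ => F ξ *
      (halfCos a b 0 ξ * p.eval (Real.cos (Real.pi * ((ξ - a) / (b - a)))) : ℝ)) volume a b :=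
    fun p => hF.mul_continuousOn (Complex.continuous_ofReal.comp
      ((continuous_halfCos a b 0).mul (p.continuous.comp (by fun_prop)))).continuousOn
  induction p using Polynomial.induction_on' with
  | add p q hp hq =>
    simp only [Polynomial.eval_add, mul_add, Complex.ofReal_add]
    rw [intervalIntegral.integral_add (hi p) (hi q), hp, hq, add_zero]
  | monomial n c =>
    have e : ∀ ξ : ℝ, F ξ * (halfCos a b 0 ξ *
        (Polynomial.monomial n c).eval (Real.cos (Real.pi * ((ξ - a) / (b - a)))) : ℝ) =
        c * (F ξ * (halfCos a b 0 ξ * Real.cos (Real.pi * ((ξ - a) / (b - a))) ^ n : ℝ)) := by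
      intro ξ
      rw [Polynomial.eval_monomial]
      push_cast
      ring
    simp_rw [e]
    rw [intervalIntegral.integral_const_mul, integral_cos_pow_mul_halfCos_eq_zero hF h, mul_zero]

/-- On [a, b] the variable ξ is a continuous function of y = cos θ through arccos, so φ is a uniform
limit of polynomials in cos θ by Weierstrass. -/
lemma integral_continuous_mul_halfCos_eq_zero {a b : ℝ} (hab : a < b) {F : ℝ → ℂ}
    (hF : IntervalIntegrable F volume a b)
    (h : ∀ k, ∫ ξ in a..b, F ξ * (halfCos a b k ξ : ℂ) = 0) {φ : ℝ → ℝ} (hφ : Continuous φ) :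
    ∫ ξ in a..b, F ξ * (halfCos a b 0 ξ * φ ξ : ℝ) = 0 := by
  have hL : 0 < b - a := sub_pos.2 hab
  have hψ : Continuous fun y : ℝ => φ (a + (b - a) * (Real.arccos y / Real.pi)) :=
    hφ.comp (by fun_prop)
  set M := ∫ ξ in a..b, ‖F ξ‖ with hM
  have hM0 : 0 ≤ M := intervalIntegral.integral_nonneg hab.le fun _ _ => norm_nonneg _
  have bound : ∀ δ > 0, ‖∫ ξ in a..b, F ξ * (halfCos a b 0 ξ * φ ξ : ℝ)‖ ≤ M * δ := by
    intro δ hδ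
    obtain ⟨p, hp⟩ := exists_polynomial_near_of_continuousOn (-1) 1
      (fun y : ℝ => φ (a + (b - a) * (Real.arccos y / Real.pi))) hψ.continuousOn δ hδ
    have hi1 : IntervalIntegrable (fun ξ => F ξ * (halfCos a b 0 ξ * φ ξ : ℝ)) volume a b :=
      hF.mul_continuousOn (Complex.continuous_ofReal.comp
        ((continuous_halfCos a b 0).mul hφ)).continuousOn
    have hi2 : IntervalIntegrable (fun ξ => F ξ * (halfCos a b 0 ξ *
        p.eval (Real.cos (Real.pi * ((ξ - a) / (b - a)))) : ℝ)) volume a b :=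
      hF.mul_continuousOn (Complex.continuous_ofReal.comp
        ((continuous_halfCos a b 0).mul (p.continuous.comp (by fun_prop)))).continuousOn
    rw [← sub_zero (∫ ξ in a..b, F ξ * (halfCos a b 0 ξ * φ ξ : ℝ)),
      ← integral_polynomial_cos_eq_zero hF h p, ← intervalIntegral.integral_sub hi1 hi2, hM,
      ← intervalIntegral.integral_mul_const]
    refine intervalIntegral.norm_integral_le_of_norm_le hab.le (.of_forall fun ξ hξ => ?_)
      (hF.norm.mul_const δ)
    have h0 : 0 ≤ (ξ - a) / (b - a) := div_nonneg (by linarith [hξ.1]) hL.le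
    have h1 : (ξ - a) / (b - a) ≤ 1 := (div_le_one hL).2 (by linarith [hξ.2])
    have hθ0 : 0 ≤ Real.pi * ((ξ - a) / (b - a)) := mul_nonneg Real.pi_pos.le h0
    have hθ1 : Real.pi * ((ξ - a) / (b - a)) ≤ Real.pi :=
      mul_le_of_le_one_right Real.pi_pos.le h1
    have h2 := hp (Real.cos (Real.pi * ((ξ - a) / (b - a))))
      ⟨Real.neg_one_le_cos _, Real.cos_le_one _⟩
    rw [Real.arccos_cos hθ0 hθ1, mul_div_cancel_left₀ _ Real.pi_ne_zero,
      mul_div_cancel₀ _ hL.ne', add_sub_cancel] at h2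
    rw [← mul_sub, norm_mul, ← Complex.ofReal_sub, ← mul_sub, Complex.norm_real, norm_mul,
      Real.norm_eq_abs, Real.norm_eq_abs, abs_sub_comm]
    refine mul_le_mul_of_nonneg_left ?_ (norm_nonneg _)
    calc _ ≤ 1 * |Polynomial.eval (Real.cos (Real.pi * ((ξ - a) / (b - a)))) p - φ ξ| :=
          mul_le_mul_of_nonneg_right (abs_halfCos_le_one _ _ _ _) (abs_nonneg _)
      _ ≤ δ := by rw [one_mul]; exact h2.le
  rw [← norm_le_zero_iff]
  refine le_of_forall_pos_le_add fun η hη => ?_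
  -- The summand 1 guards against M = 0.
  refine (bound (η / (M + 1)) (by positivity)).trans ?_
  rw [zero_add, ← mul_div_assoc, div_le_iff₀ (by positivity)]
  nlinarith

/-- The half-integer cosines are total on an interval. -/
lemma ae_eq_zero_of_integral_halfCos_eq_zero {a b : ℝ} (hab : a < b) {F : ℝ → ℂ}
    (hF : IntervalIntegrable F volume a b)
    (h : ∀ k, ∫ ξ in a..b, F ξ * (halfCos a b k ξ : ℂ) = 0) :
    ∀ᵐ ξ : ℝ, ξ ∈ Set.Ioo a b → F ξ = 0 := by
  have hL : 0 < b - a := sub_pos.2 hab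
  have hloc : LocallyIntegrableOn (fun ξ => F ξ * (halfCos a b 0 ξ : ℂ)) (Set.Ioo a b) := by
    apply IntegrableOn.locallyIntegrableOn
    have h1 : IntervalIntegrable (fun ξ => F ξ * (halfCos a b 0 ξ : ℂ)) volume a b :=
      hF.mul_continuousOn (Complex.continuous_ofReal.comp
        (continuous_halfCos a b 0)).continuousOn
    exact ((intervalIntegrable_iff_integrableOn_Ioc_of_le hab.le).1 h1).mono_set
      Set.Ioo_subset_Ioc_self
  -- The function `F` times the lowest cosine annihilates all test functions, and that cosine can be
  -- divided out: its angle stays in (0, π/2).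
  have key := isOpen_Ioo.ae_eq_zero_of_integral_contDiff_smul_eq_zero hloc (by
    intro g hg _ hgs
    have h1 := integral_continuous_mul_halfCos_eq_zero hab hF h hg.continuous
    rw [intervalIntegral.integral_eq_integral_of_support_subset] at h1
    · rw [← h1]
      refine integral_congr_ae (.of_forall fun ξ => ?_)
      simp only [Complex.real_smul, Complex.ofReal_mul]
      ring
    · intro ξ hξ
      have : ξ ∈ tsupport g := subset_tsupport g fun h0 => hξ (by simp [h0])
      exact Set.Ioo_subset_Ioc_self (hgs this))
  filter_upwards [key] with ξ h1 hξ
  have h0 : 0 < (ξ - a) / (b - a) := div_pos (by linarith [hξ.1]) hL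
  have h3 : (ξ - a) / (b - a) < 1 := (div_lt_one hL).2 (by linarith [hξ.2])
  have hpos : 0 < halfCos a b 0 ξ := by
    apply Real.cos_pos_of_mem_Ioo
    constructor <;> push_cast <;> nlinarith [Real.pi_pos]
  exact (mul_eq_zero.1 (h1 hξ)).resolve_right (by exact_mod_cast hpos.ne')

/-! ### The local cosine basis of an interval -/

/-- The support reaches at most one interval length beyond each endpoint; the two outer pieces are
reflected into [a, b]. -/
lemma integral_eq_integral_fold {E : Type*} [NormedAddCommGroup E] [NormedSpace ℝ E]
    {a b : ℝ} {G : ℝ → E} (hG : Integrable G)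
    (hs : Function.support G ⊆ Set.Ioc (2 * a - b) (2 * b - a)) :
    ∫ ξ, G ξ = ∫ ξ in a..b, (G ξ + G (2 * a - ξ) + G (2 * b - ξ)) := by
  have hi : ∀ c d, IntervalIntegrable G volume c d := fun c d => hG.intervalIntegrable
  have hr : ∀ t c d, IntervalIntegrable (fun ξ => G (2 * t - ξ)) volume c d := fun t c d =>
    (hG.comp_sub_left (2 * t)).intervalIntegrable
  rw [intervalIntegral.integral_add ((hi _ _).add (hr _ _ _)) (hr _ _ _),
    intervalIntegral.integral_add (hi _ _) (hr _ _ _), intervalIntegral.integral_comp_sub_left,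
    intervalIntegral.integral_comp_sub_left,
    ← intervalIntegral.integral_eq_integral_of_support_subset hs,
    ← intervalIntegral.integral_add_adjacent_intervals (hi (2 * a - b) a) (hi a (2 * b - a)),
    ← intervalIntegral.integral_add_adjacent_intervals (hi a b) (hi b (2 * b - a)),
    show 2 * a - a = a by ring, show 2 * b - b = b by ring]
  abel

/-- Admissible endpoints and cutoff radii of an interval. -/
structure Admissible (a b ε ε' : ℝ) : Prop where
  left_pos : 0 < ε
  right_pos : 0 < ε'
  add_le : ε + ε' ≤ b - a

namespace Admissible

variable {ρ : ℝ → ℝ} {a b ε ε' : ℝ} (hI : Admissible a b ε ε') (hρ : IsRamp ρ)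

include hI in
lemma lt : a < b := by linarith [hI.left_pos, hI.right_pos, hI.add_le]

include hI hρ

lemma bell_eq_left {ξ : ℝ} (h : ξ ≤ a + ε) : bell ρ a b ε ε' ξ = ρ ((ξ - a) / ε) := by
  rw [bell, hρ.cut_eq_one' hI.right_pos (by linarith [hI.add_le]), mul_one]

lemma bell_eq_right {ξ : ℝ} (h : b - ε' ≤ ξ) : bell ρ a b ε ε' ξ = ρ ((b - ξ) / ε') := by
  rw [bell, hρ.cut_eq_one hI.left_pos (by linarith [hI.add_le]), one_mul]

lemma bell_eq_zero_left {ξ : ℝ} (h : ξ ≤ a - ε) : bell ρ a b ε ε' ξ = 0 := by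
  rw [bell, hρ.cut_eq_zero hI.left_pos h, zero_mul]

lemma bell_eq_zero_right {ξ : ℝ} (h : b + ε' ≤ ξ) : bell ρ a b ε ε' ξ = 0 := by
  rw [bell, hρ.cut_eq_zero' hI.right_pos h, mul_zero]

lemma support_bell_subset : Function.support (bell ρ a b ε ε') ⊆ Set.Ioo (a - ε) (b + ε') := by
  intro ξ hξ
  by_contra h
  rw [Set.mem_Ioo, not_and_or, not_lt, not_lt] at h
  rcases h with h | h
  · exact hξ (hI.bell_eq_zero_left hρ h)
  · exact hξ (hI.bell_eq_zero_right hρ h)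

/-- Since ε + ε' ≤ b - a, at each point at most one of the two reflected terms survives, and the
ramp identity applies at the corresponding endpoint. This makes folding preserve inner products. -/
lemma bell_sq_fold (ξ : ℝ) (hξ : ξ ∈ Set.Icc a b) :
    bell ρ a b ε ε' ξ ^ 2 + bell ρ a b ε ε' (2 * a - ξ) ^ 2 + bell ρ a b ε ε' (2 * b - ξ) ^ 2 = 1 := by
  have := hI.left_pos
  have := hI.right_pos
  have := hI.add_le
  obtain ⟨h1, h2⟩ := hξ
  rcases le_total ξ (a + ε) with h | h
  · rw [hI.bell_eq_left hρ h, hI.bell_eq_left hρ (by linarith),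
      hI.bell_eq_zero_right hρ (by linarith), show 2 * a - ξ - a = a - ξ by ring]
    linarith [hρ.sq_add_sq_cut a ε ξ]
  · rw [hI.bell_eq_zero_left hρ (ξ := 2 * a - ξ) (by linarith)]
    rw [bell, hρ.cut_eq_one hI.left_pos h, hI.bell_eq_right hρ (ξ := 2 * b - ξ) (by linarith),
      show b - (2 * b - ξ) = ξ - b by ring]
    linarith [hρ.sq_add_sq_cut b ε' ξ]

omit hI in
lemma contDiff_brushletHat (k : ℕ) : ContDiff ℝ ∞ (brushletHat ρ a b ε ε' k) := by
  unfold brushletHat bell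
  have := hρ.smooth
  have h1 : ContDiff ℝ ∞ fun ξ : ℝ => ρ ((ξ - a) / ε) := this.comp (by fun_prop)
  have h2 : ContDiff ℝ ∞ fun ξ : ℝ => ρ ((b - ξ) / ε') := this.comp (by fun_prop)
  fun_prop

lemma hasCompactSupport_bell : HasCompactSupport (bell ρ a b ε ε') :=
  HasCompactSupport.of_support_subset_isCompact isCompact_Icc
    ((hI.support_bell_subset hρ).trans Set.Ioo_subset_Icc_self)

lemma hasCompactSupport_brushletHat (k : ℕ) : HasCompactSupport (brushletHat ρ a b ε ε' k) :=
  HasCompactSupport.of_support_subset_isCompact isCompact_Icc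
    (Function.support_subset_iff'.2 fun ξ hξ => by
      have : bell ρ a b ε ε' ξ = 0 := by
        by_contra h
        exact hξ (Set.Ioo_subset_Icc_self (hI.support_bell_subset hρ h))
      simp [brushletHat, this])

/-- The local cosine function as a Schwartz function. -/
def schwartzHat (k : ℕ) : SchwartzMap ℝ ℂ :=
  HasCompactSupport.toSchwartzMap (f := fun ξ => (brushletHat ρ a b ε ε' k ξ : ℂ))
    ((hI.hasCompactSupport_brushletHat hρ k).comp_left Complex.ofReal_zero)
    (Complex.ofRealCLM.contDiff.comp (contDiff_brushletHat hρ k))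

lemma schwartzHat_apply (k : ℕ) (ξ : ℝ) :
    hI.schwartzHat hρ k ξ = brushletHat ρ a b ε ε' k ξ := rfl

/-- The local cosine function as an element of `L²(ℝ)`. -/
def lpHat (k : ℕ) : Lp ℂ 2 (volume : Measure ℝ) := (hI.schwartzHat hρ k).toLp 2

lemma coeFn_lpHat (k : ℕ) :
    ⇑(hI.lpHat hρ k) =ᵐ[volume] fun ξ => (brushletHat ρ a b ε ε' k ξ : ℂ) :=
  (hI.schwartzHat hρ k).coeFn_toLp 2

omit hI hρ in
lemma brushletHat_eq (k : ℕ) (ξ : ℝ) : brushletHat ρ a b ε ε' k ξ =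
    √(2 / (b - a)) * bell ρ a b ε ε' ξ * halfCos a b k ξ := rfl

lemma lpHat_mem_rightSpace (k : ℕ) : hI.lpHat hρ k ∈ rightSpace ρ a ε := by
  have h := hI.coeFn_lpHat hρ k
  filter_upwards [h, ae_reflect a h] with ξ h1 h2
  rw [h1, h2]
  norm_cast
  rw [brushletHat_eq, brushletHat_eq, halfCos_reflect_left]
  rcases le_total ξ (a - ε) with h3 | h3
  · rw [hI.bell_eq_zero_left hρ h3, hρ.cut_eq_zero hI.left_pos h3]; ring
  rcases le_total (a + ε) ξ with h4 | h4
  · rw [hI.bell_eq_zero_left hρ (ξ := 2 * a - ξ) (by linarith), hρ.cut_eq_zero' hI.left_pos h4]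
    ring
  · rw [hI.bell_eq_left hρ h4, hI.bell_eq_left hρ (ξ := 2 * a - ξ) (by linarith),
      show 2 * a - ξ - a = a - ξ by ring]
    ring

lemma lpHat_mem_leftSpace (k : ℕ) : hI.lpHat hρ k ∈ leftSpace ρ b ε' := by
  have h := hI.coeFn_lpHat hρ k
  filter_upwards [h, ae_reflect b h] with ξ h1 h2
  rw [h1, h2]
  norm_cast
  rw [brushletHat_eq, brushletHat_eq, halfCos_reflect_right hI.lt]
  rcases le_total ξ (b - ε') with h3 | h3
  · rw [hI.bell_eq_zero_right hρ (ξ := 2 * b - ξ) (by linarith), hρ.cut_eq_zero hI.right_pos h3]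
    ring
  rcases le_total (b + ε') ξ with h4 | h4
  · rw [hI.bell_eq_zero_right hρ h4, hρ.cut_eq_zero' hI.right_pos h4]
    ring
  · rw [hI.bell_eq_right hρ h3, hI.bell_eq_right hρ (ξ := 2 * b - ξ) (by linarith),
      show b - (2 * b - ξ) = ξ - b by ring]
    ring

omit hI in
lemma continuous_bell : Continuous (bell ρ a b ε ε') := by
  unfold bell
  have := hρ.continuous
  fun_prop

lemma support_bell_subset_Ioc :
    Function.support (bell ρ a b ε ε') ⊆ Set.Ioc (2 * a - b) (2 * b - a) := by
  intro ξ hξ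
  have := hI.left_pos
  have := hI.right_pos
  have := hI.add_le
  have h := hI.support_bell_subset hρ hξ
  exact ⟨by linarith [h.1], by linarith [h.2]⟩

lemma integral_brushletHat_mul_brushletHat (k l : ℕ) :
    ∫ ξ, brushletHat ρ a b ε ε' k ξ * brushletHat ρ a b ε ε' l ξ = if k = l then 1 else 0 := by
  have hab := hI.lt
  have hL : 0 < b - a := sub_pos.2 hab
  rw [integral_eq_integral_fold (a := a) (b := b)]
  · have e : ∀ ξ ∈ Set.uIcc a b,
        brushletHat ρ a b ε ε' k ξ * brushletHat ρ a b ε ε' l ξ +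
          brushletHat ρ a b ε ε' k (2 * a - ξ) * brushletHat ρ a b ε ε' l (2 * a - ξ) +
          brushletHat ρ a b ε ε' k (2 * b - ξ) * brushletHat ρ a b ε ε' l (2 * b - ξ) =
        2 / (b - a) * (halfCos a b k ξ * halfCos a b l ξ) := by
      intro ξ hξ
      rw [Set.uIcc_of_le hab.le] at hξ
      have h1 := hI.bell_sq_fold hρ ξ hξ
      have h2 : √(2 / (b - a)) ^ 2 = 2 / (b - a) := Real.sq_sqrt (by positivity)
      simp only [brushletHat_eq, halfCos_reflect_left, halfCos_reflect_right hab]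
      linear_combination (√(2 / (b - a)) ^ 2 * halfCos a b k ξ * halfCos a b l ξ) * h1 +
        halfCos a b k ξ * halfCos a b l ξ * h2
    rw [intervalIntegral.integral_congr e, intervalIntegral.integral_const_mul,
      integral_halfCos_mul_halfCos hab]
    split_ifs
    · field_simp
    · simp
  · exact ((contDiff_brushletHat hρ k).continuous.mul
      (contDiff_brushletHat hρ l).continuous).integrable_of_hasCompactSupport
      (hI.hasCompactSupport_brushletHat hρ k).mul_right
  · intro ξ hξ
    apply hI.support_bell_subset_Ioc hρ
    intro h
    exact hξ (by simp [brushletHat_eq, h])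

lemma orthonormal_lpHat : Orthonormal ℂ (hI.lpHat hρ) := by
  rw [orthonormal_iff_ite]
  intro k l
  rw [L2.inner_def]
  have e : (fun ξ => ⟪hI.lpHat hρ k ξ, hI.lpHat hρ l ξ⟫) =ᵐ[volume] fun ξ =>
      ((brushletHat ρ a b ε ε' k ξ * brushletHat ρ a b ε ε' l ξ : ℝ) : ℂ) := by
    filter_upwards [hI.coeFn_lpHat hρ k, hI.coeFn_lpHat hρ l] with ξ h1 h2
    rw [h1, h2, RCLike.inner_apply, Complex.conj_ofReal]
    push_cast
    ring
  rw [integral_congr_ae e, integral_complex_ofReal, hI.integral_brushletHat_mul_brushletHat hρ]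
  split_ifs <;> simp

lemma integrable_bell_mul (f : Lp ℂ 2 (volume : Measure ℝ)) :
    Integrable fun ξ => (bell ρ a b ε ε' ξ : ℂ) * f ξ := by
  have h1 : MemLp (fun ξ => (bell ρ a b ε ε' ξ : ℂ)) 2 volume :=
    (Complex.continuous_ofReal.comp (continuous_bell hρ)).memLp_of_hasCompactSupport
      ((hI.hasCompactSupport_bell hρ).comp_left Complex.ofReal_zero)
  exact h1.integrable_mul (Lp.memLp f)

/-- Folding exhibits the coefficient as a cosine coefficient of one function on (a, b); the minus
sign comes from the oddness of the cosine about b. -/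
lemma inner_lpHat (f : Lp ℂ 2 (volume : Measure ℝ)) (k : ℕ) :
    ⟪hI.lpHat hρ k, f⟫ = √(2 / (b - a)) * ∫ ξ in a..b,
      ((bell ρ a b ε ε' ξ : ℂ) * f ξ + bell ρ a b ε ε' (2 * a - ξ) * f (2 * a - ξ) -
        bell ρ a b ε ε' (2 * b - ξ) * f (2 * b - ξ)) * halfCos a b k ξ := by
  rw [L2.inner_def]
  have e : (fun ξ => ⟪hI.lpHat hρ k ξ, f ξ⟫) =ᵐ[volume] fun ξ =>
      (√(2 / (b - a)) : ℂ) * ((bell ρ a b ε ε' ξ : ℂ) * f ξ * halfCos a b k ξ) := by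
    filter_upwards [hI.coeFn_lpHat hρ k] with ξ h1
    rw [h1, RCLike.inner_apply, Complex.conj_ofReal, brushletHat_eq]
    push_cast
    ring
  rw [integral_congr_ae e, integral_const_mul, integral_eq_integral_fold (a := a) (b := b)]
  · congr 1
    refine intervalIntegral.integral_congr fun ξ _ => ?_
    simp only [halfCos_reflect_left, halfCos_reflect_right hI.lt]
    push_cast
    ring
  · refine (hI.integrable_bell_mul hρ f).mul_bdd (c := 1)
      (Complex.continuous_ofReal.comp (continuous_halfCos a b k)).aestronglyMeasurable
      (.of_forall fun ξ => ?_)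
    simpa using abs_halfCos_le_one a b k ξ
  · intro ξ hξ
    apply hI.support_bell_subset_Ioc hρ
    intro h
    exact hξ (by simp [h])

/-- Folding is injective on the space of the interval. Near an endpoint, the vanishing of the fold
and the symmetry relation form a 2 × 2 system in f and its reflection, whose matrix is orthogonal by
the ramp identity. -/
lemma eq_zero_of_fold_eq_zero {f : Lp ℂ 2 (volume : Measure ℝ)} (hfa : f ∈ rightSpace ρ a ε)
    (hfb : f ∈ leftSpace ρ b ε')
    (h : ∀ᵐ ξ : ℝ, ξ ∈ Set.Ioo a b →
      (bell ρ a b ε ε' ξ : ℂ) * f ξ + bell ρ a b ε ε' (2 * a - ξ) * f (2 * a - ξ) -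
        bell ρ a b ε ε' (2 * b - ξ) * f (2 * b - ξ) = 0) : f = 0 := by
  have hε := hI.left_pos
  have hε' := hI.right_pos
  have hle := hI.add_le
  have hA : ∀ᵐ ξ : ℝ, ξ ∈ Set.Ioo a (a + ε) →
      (ρ ((ξ - a) / ε) : ℂ) * f ξ + ρ ((a - ξ) / ε) * f (2 * a - ξ) = 0 := by
    filter_upwards [h] with ξ h1 h2
    have h3 := h1 ⟨h2.1, by linarith [h2.2]⟩
    rwa [hI.bell_eq_left hρ h2.2.le, hI.bell_eq_left hρ (by linarith [h2.1]),
      hI.bell_eq_zero_right hρ (by linarith [h2.2]), show 2 * a - ξ - a = a - ξ by ring,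
      Complex.ofReal_zero, zero_mul, sub_zero] at h3
  have hB : ∀ᵐ ξ : ℝ, ξ ∈ Set.Ioo (b - ε') b →
      (ρ ((b - ξ) / ε') : ℂ) * f ξ - ρ ((ξ - b) / ε') * f (2 * b - ξ) = 0 := by
    filter_upwards [h] with ξ h1 h2
    have h3 := h1 ⟨by linarith [h2.1], h2.2⟩
    rwa [hI.bell_eq_right hρ h2.1.le, hI.bell_eq_zero_left hρ (ξ := 2 * a - ξ) (by linarith [h2.1]),
      hI.bell_eq_right hρ (ξ := 2 * b - ξ) (by linarith [h2.2]),
      show b - (2 * b - ξ) = ξ - b by ring, Complex.ofReal_zero, zero_mul, add_zero] at h3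
  have hne : ∀ t : ℝ, ∀ᵐ ξ : ℝ, ξ ≠ t := fun t => by simp [ae_iff]
  rw [Lp.eq_zero_iff_ae_eq_zero]
  filter_upwards [h, hA, ae_reflect a hA, hB, ae_reflect b hB, hfa, hfb, hne a, hne b,
    hρ.ae_eq_zero_of_mem_rightSpace hε hfa, hρ.ae_eq_zero_of_mem_leftSpace hε' hfb]
    with ξ h1 a1 a2 b1 b2 ha hb na nb za zb
  rw [Pi.zero_apply]
  rw [show 2 * a - ξ - a = a - ξ by ring, show a - (2 * a - ξ) = ξ - a by ring,
    show 2 * a - (2 * a - ξ) = ξ by ring] at a2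
  rw [show 2 * b - ξ - b = b - ξ by ring, show b - (2 * b - ξ) = ξ - b by ring,
    show 2 * b - (2 * b - ξ) = ξ by ring] at b2
  have ca := hρ.sq_add_sq_cut_complex a ε ξ
  have cb := hρ.sq_add_sq_cut_complex b ε' ξ
  rcases le_or_gt ξ (a - ε) with c1 | c1
  · exact za c1
  rcases le_or_gt (b + ε') ξ with c2 | c2
  · exact zb c2
  rcases lt_or_ge ξ (a + ε) with c3 | c3
  · have key : (ρ ((ξ - a) / ε) : ℂ) * f ξ + ρ ((a - ξ) / ε) * f (2 * a - ξ) = 0 := by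
      -- The fold is known only inside (a, b); outside, its equation is read at the reflected point.
      rcases lt_or_gt_of_ne na with c4 | c4
      · rw [add_comm]; exact a2 ⟨by linarith, by linarith⟩
      · exact a1 ⟨c4, c3⟩
    linear_combination (-f ξ) * ca + (ρ ((ξ - a) / ε) : ℂ) * key + (ρ ((a - ξ) / ε) : ℂ) * ha
  rcases lt_or_ge (b - ε') ξ with c5 | c5
  · have key : (ρ ((b - ξ) / ε') : ℂ) * f ξ - ρ ((ξ - b) / ε') * f (2 * b - ξ) = 0 := by
      rcases lt_or_gt_of_ne nb with c4 | c4
      · exact b1 ⟨c5, c4⟩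
      · rw [← neg_eq_zero, neg_sub]; exact b2 ⟨by linarith, by linarith⟩
    linear_combination (-f ξ) * cb + (ρ ((b - ξ) / ε') : ℂ) * key + (ρ ((ξ - b) / ε') : ℂ) * hb
  · have h2 := h1 ⟨by linarith, by linarith⟩
    rw [hI.bell_eq_zero_left hρ (ξ := 2 * a - ξ) (by linarith),
      hI.bell_eq_zero_right hρ (ξ := 2 * b - ξ) (by linarith), bell,
      hρ.cut_eq_one hε c3, hρ.cut_eq_one' hε' c5] at h2
    simpa using h2

/-- The local cosine functions are total in the space of the interval. -/
lemma eq_zero_of_inner_lpHat_eq_zero {f : Lp ℂ 2 (volume : Measure ℝ)}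
    (hfa : f ∈ rightSpace ρ a ε) (hfb : f ∈ leftSpace ρ b ε')
    (h : ∀ k, ⟪hI.lpHat hρ k, f⟫ = 0) : f = 0 := by
  have hL : 0 < b - a := sub_pos.2 hI.lt
  refine hI.eq_zero_of_fold_eq_zero hρ hfa hfb
    (ae_eq_zero_of_integral_halfCos_eq_zero hI.lt ?_ fun k => ?_)
  · have h1 := hI.integrable_bell_mul hρ f
    exact ((h1.add (h1.comp_sub_left (2 * a))).sub (h1.comp_sub_left (2 * b))).intervalIntegrable
  · have h1 := h k
    rw [hI.inner_lpHat hρ, mul_eq_zero] at h1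
    refine h1.resolve_left ?_
    have : √(2 / (b - a)) ≠ 0 := (Real.sqrt_pos.2 (by positivity)).ne'
    exact_mod_cast this

end Admissible

/-! ### Brushlets as inverse Fourier transforms -/

/-- The transform `Lp.fourierTransformₗᵢ` has the kernel exp(-2πixξ), so intervals and radii are
measured in the variable ξ / 2π. -/
lemma Admissible.scale {a b ε ε' : ℝ} (hI : Admissible a b ε ε') :
    Admissible (a / (2 * Real.pi)) (b / (2 * Real.pi)) (ε / (2 * Real.pi))
      (ε' / (2 * Real.pi)) where
  left_pos := div_pos hI.left_pos Real.two_pi_pos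
  right_pos := div_pos hI.right_pos Real.two_pi_pos
  add_le := by
    rw [← add_div, ← sub_div]
    exact div_le_div_of_nonneg_right hI.add_le Real.two_pi_pos.le

lemma brushletHat_two_pi_mul (ρ : ℝ → ℝ) (a b ε ε' : ℝ) (k : ℕ) (v : ℝ) :
    √(2 * Real.pi) * brushletHat ρ a b ε ε' k (2 * Real.pi * v) =
      brushletHat ρ (a / (2 * Real.pi)) (b / (2 * Real.pi)) (ε / (2 * Real.pi))
        (ε' / (2 * Real.pi)) k v := by
  have h0 : (2 * Real.pi) ≠ 0 := Real.two_pi_pos.ne'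
  have e1 : ∀ c d : ℝ, (v - c / (2 * Real.pi)) / (d / (2 * Real.pi)) =
      (2 * Real.pi * v - c) / d := fun c d => by
    rw [← mul_div_mul_left _ _ h0, mul_sub, mul_div_cancel₀ _ h0, mul_div_cancel₀ _ h0]
  have e2 : ∀ c d : ℝ, (c / (2 * Real.pi) - v) / (d / (2 * Real.pi)) =
      (c - 2 * Real.pi * v) / d := fun c d => by
    rw [← mul_div_mul_left _ _ h0, mul_sub, mul_div_cancel₀ _ h0, mul_div_cancel₀ _ h0]
  have e3 : 2 / (b / (2 * Real.pi) - a / (2 * Real.pi)) = 2 * Real.pi * (2 / (b - a)) := by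
    rw [← sub_div, div_div_eq_mul_div]; ring
  rw [brushletHat, brushletHat, bell, bell, e1, e2, e3, ← sub_div, e1,
    Real.sqrt_mul Real.two_pi_pos.le]
  ring

lemma brushlet_eq_fourierInv {ρ : ℝ → ℝ} (hρ : IsRamp ρ) {a b ε ε' : ℝ}
    (hI : Admissible a b ε ε') (k : ℕ) (x : ℝ) :
    brushlet ρ a b ε ε' k x =
      (FourierTransformInv.fourierInv (hI.scale.schwartzHat hρ k) : SchwartzMap ℝ ℂ) x := by
  have h0 : 0 < 2 * Real.pi := Real.two_pi_pos
  rw [SchwartzMap.fourierInv_coe, Real.fourierInv_eq', brushlet]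
  have h1 := Measure.integral_comp_mul_left (fun ξ : ℝ => Complex.exp (Complex.I * x * ξ) *
    (brushletHat ρ a b ε ε' k ξ : ℂ)) (2 * Real.pi)
  have h2 : (∫ ξ : ℝ, Complex.exp (Complex.I * x * ξ) * (brushletHat ρ a b ε ε' k ξ : ℂ)) =
      (2 * Real.pi : ℝ) * ∫ v : ℝ, Complex.exp (Complex.I * x * (2 * Real.pi * v : ℝ)) *
        (brushletHat ρ a b ε ε' k (2 * Real.pi * v) : ℂ) := by
    rw [h1, abs_of_pos (inv_pos.2 h0), Complex.real_smul, ← mul_assoc, ← Complex.ofReal_mul,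
      mul_inv_cancel₀ h0.ne', Complex.ofReal_one, one_mul]
  rw [h2, ← mul_assoc, ← Complex.ofReal_mul, ← integral_const_mul]
  refine integral_congr_ae (.of_forall fun v => ?_)
  simp only [Admissible.schwartzHat_apply, smul_eq_mul, ← brushletHat_two_pi_mul,
    RCLike.inner_apply, conj_trivial]
  have h3 : (√(2 * Real.pi))⁻¹ * (2 * Real.pi) = √(2 * Real.pi) := by
    have := Real.mul_self_sqrt h0.le
    have h4 : √(2 * Real.pi) ≠ 0 := (Real.sqrt_pos.2 h0).ne'
    field_simp
    linarith
  rw [h3, show Complex.I * x * (2 * Real.pi * v : ℝ) = ((2 * Real.pi * (x * v) : ℝ) : ℂ) * Complex.I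
    by push_cast; ring]
  push_cast
  ring

lemma coeFn_fourierInv_lpHat {ρ : ℝ → ℝ} (hρ : IsRamp ρ) {a b ε ε' : ℝ}
    (hI : Admissible a b ε ε') (k : ℕ) :
    ⇑((Lp.fourierTransformₗᵢ ℝ ℂ).symm (hI.scale.lpHat hρ k)) =ᵐ[volume]
      brushlet ρ a b ε ε' k := by
  have h1 : (Lp.fourierTransformₗᵢ ℝ ℂ).symm (hI.scale.lpHat hρ k) =
      (FourierTransformInv.fourierInv (hI.scale.schwartzHat hρ k) : SchwartzMap ℝ ℂ).toLp 2 :=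
    SchwartzMap.toLp_fourierInv_eq _
  rw [h1]
  filter_upwards [SchwartzMap.coeFn_toLp (FourierTransformInv.fourierInv
    (hI.scale.schwartzHat hρ k) : SchwartzMap ℝ ℂ) 2 volume] with x hx
  rw [hx, brushlet_eq_fourierInv hρ hI]

/-! ### Tensor products in `L²` of the plane -/

/-- The Hilbert space `L²(ℝ)`. -/
abbrev L2Line := Lp ℂ 2 (volume : Measure ℝ)

/-- The Hilbert space `L²(ℝ²)`. -/
abbrev L2Plane := Lp ℂ 2 (volume : Measure (ℝ × ℝ))

lemma memLp_tensor (f g : L2Line) :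
    MemLp (fun x : ℝ × ℝ => f x.1 * g x.2) 2 volume := by
  have hf := Lp.memLp f
  have hg := Lp.memLp g
  have hm : AEStronglyMeasurable (fun x : ℝ × ℝ => f x.1 * g x.2) volume :=
    hf.1.comp_fst.mul hg.1.comp_snd
  rw [memLp_two_iff_integrable_sq_norm hm]
  have := ((memLp_two_iff_integrable_sq_norm hf.1).1 hf).mul_prod
    ((memLp_two_iff_integrable_sq_norm hg.1).1 hg)
  refine this.congr (.of_forall fun x => ?_)
  simp [mul_pow]

/-- The tensor product of two functions as an element of `L²(ℝ²)`. -/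
def tensorLp (f g : L2Line) : L2Plane := (memLp_tensor f g).toLp _

lemma coeFn_tensorLp (f g : L2Line) : ⇑(tensorLp f g) =ᵐ[volume] fun x => f x.1 * g x.2 :=
  (memLp_tensor f g).coeFn_toLp

lemma ae_fst {p : ℝ → Prop} (h : ∀ᵐ x : ℝ, p x) : ∀ᵐ x : ℝ × ℝ, p x.1 :=
  Measure.quasiMeasurePreserving_fst.ae h

lemma ae_snd {p : ℝ → Prop} (h : ∀ᵐ x : ℝ, p x) : ∀ᵐ x : ℝ × ℝ, p x.2 :=
  Measure.quasiMeasurePreserving_snd.ae h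

lemma inner_tensorLp (f g f' g' : L2Line) :
    ⟪tensorLp f g, tensorLp f' g'⟫ = ⟪f, f'⟫ * ⟪g, g'⟫ := by
  rw [L2.inner_def, L2.inner_def, L2.inner_def, ← integral_prod_mul]
  refine integral_congr_ae ?_
  filter_upwards [coeFn_tensorLp f g, coeFn_tensorLp f' g'] with x h1 h2
  rw [h1, h2]
  simp only [RCLike.inner_apply, map_mul]
  ring

lemma norm_tensorLp (f g : L2Line) : ‖tensorLp f g‖ = ‖f‖ * ‖g‖ := by
  have h := inner_tensorLp f g f g
  simp only [inner_self_eq_norm_sq_to_K] at h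
  norm_cast at h
  rw [← mul_pow] at h
  exact (sq_eq_sq₀ (norm_nonneg _) (by positivity)).1 (by exact_mod_cast h)

/-- The tensor product as a continuous bilinear map. -/
def tensorCLM : L2Line →L[ℂ] L2Line →L[ℂ] L2Plane :=
  LinearMap.mkContinuous₂ (LinearMap.mk₂ ℂ tensorLp
    (by
      intro f f' g
      refine Lp.ext ?_
      filter_upwards [coeFn_tensorLp (f + f') g, Lp.coeFn_add (tensorLp f g) (tensorLp f' g),
        coeFn_tensorLp f g, coeFn_tensorLp f' g, ae_fst (Lp.coeFn_add f f')] with x h1 h2 h3 h4 h5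
      rw [h1, h2, Pi.add_apply, h3, h4, h5, Pi.add_apply, add_mul])
    (by
      intro c f g
      refine Lp.ext ?_
      filter_upwards [coeFn_tensorLp (c • f) g, Lp.coeFn_smul c (tensorLp f g),
        coeFn_tensorLp f g, ae_fst (Lp.coeFn_smul c f)] with x h1 h2 h3 h5
      rw [h1, h2, Pi.smul_apply, h3, h5, Pi.smul_apply, smul_mul_assoc])
    (by
      intro f g g'
      refine Lp.ext ?_
      filter_upwards [coeFn_tensorLp f (g + g'), Lp.coeFn_add (tensorLp f g) (tensorLp f g'),
        coeFn_tensorLp f g, coeFn_tensorLp f g', ae_snd (Lp.coeFn_add g g')] with x h1 h2 h3 h4 h5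
      rw [h1, h2, Pi.add_apply, h3, h4, h5, Pi.add_apply, mul_add])
    (by
      intro c f g
      refine Lp.ext ?_
      filter_upwards [coeFn_tensorLp f (c • g), Lp.coeFn_smul c (tensorLp f g),
        coeFn_tensorLp f g, ae_snd (Lp.coeFn_smul c g)] with x h1 h2 h3 h5
      rw [h1, h2, Pi.smul_apply, h3, h5, Pi.smul_apply, mul_smul_comm])) 1
    (fun f g => by rw [one_mul]; exact (norm_tensorLp f g).le)

lemma setIntegral_prod_eq_inner_tensorLp (h : L2Plane) {s t : Set ℝ} (hs : MeasurableSet s)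
    (ht : MeasurableSet t) (hs' : volume s ≠ ⊤) (ht' : volume t ≠ ⊤) :
    ⟪tensorLp (indicatorConstLp 2 hs hs' 1) (indicatorConstLp 2 ht ht' 1), h⟫ =
      ∫ x in s ×ˢ t, h x := by
  rw [L2.inner_def, ← integral_indicator (hs.prod ht)]
  refine integral_congr_ae ?_
  filter_upwards [coeFn_tensorLp (indicatorConstLp 2 hs hs' 1) (indicatorConstLp 2 ht ht' 1),
    ae_fst (indicatorConstLp_coeFn (p := 2) (hs := hs) (hμs := hs') (c := (1 : ℂ))),
    ae_snd (indicatorConstLp_coeFn (p := 2) (hs := ht) (hμs := ht') (c := (1 : ℂ)))]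
    with x h1 h2 h3
  rw [h1, h2, h3, RCLike.inner_apply]
  by_cases k1 : x.1 ∈ s <;> by_cases k2 : x.2 ∈ t <;> simp [k1, k2, Set.indicator, Set.mem_prod]

/-- The tensor products are total in `L²(ℝ²)`. -/
lemma eq_zero_of_inner_tensorLp_eq_zero {h : L2Plane} (hh : ∀ f g, ⟪tensorLp f g, h⟫ = 0) :
    h = 0 := by
  -- On a bounded square `h` is integrable. Its integrals over rectangles are inner products with
  -- tensor products of indicators, hence zero, and the π-λ theorem extends this to all measurable
  -- sets.
  have hloc : ∀ n : ℕ, ∀ᵐ x : ℝ × ℝ,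
      x ∈ Set.Ioo (-n : ℝ) n ×ˢ Set.Ioo (-n : ℝ) n → h x = 0 := by
    intro n
    set B := Set.Ioo (-n : ℝ) n with hB
    have hBm : MeasurableSet B := measurableSet_Ioo
    have hBf : volume B ≠ ⊤ := measure_Ioo_lt_top.ne
    have hBBf : volume (B ×ˢ B) ≠ ⊤ := by
      rw [Measure.volume_eq_prod, Measure.prod_prod]
      exact ENNReal.mul_ne_top hBf hBf
    have : IsFiniteMeasure ((volume : Measure (ℝ × ℝ)).restrict (B ×ˢ B)) :=
      ⟨by rw [Measure.restrict_apply_univ]; exact hBBf.lt_top⟩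
    have hint : Integrable h ((volume : Measure (ℝ × ℝ)).restrict (B ×ˢ B)) :=
      ((Lp.memLp h).restrict _).integrable one_le_two
    have hrect : ∀ s t : Set ℝ, MeasurableSet s → MeasurableSet t →
        ∫ x in s ×ˢ t, h x ∂(volume.restrict (B ×ˢ B)) = 0 := by
      intro s t hs ht
      rw [Measure.restrict_restrict (hs.prod ht), Set.prod_inter_prod,
        ← setIntegral_prod_eq_inner_tensorLp h (hs.inter hBm) (ht.inter hBm)
          (measure_ne_top_of_subset Set.inter_subset_right hBf)
          (measure_ne_top_of_subset Set.inter_subset_right hBf)]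
      exact hh _ _
    have hall : ∀ A : Set (ℝ × ℝ), MeasurableSet A →
        ∫ x in A, h x ∂(volume.restrict (B ×ˢ B)) = 0 := by
      intro A hA
      induction A, hA using MeasurableSpace.induction_on_inter generateFrom_prod.symm
        isPiSystem_prod with
      | empty => simp
      | basic A hA =>
        obtain ⟨s, hs, t, ht, rfl⟩ := hA
        exact hrect s t hs ht
      | compl A hA ih =>
        have h1 := integral_add_compl hA hint
        have h2 := hrect Set.univ Set.univ .univ .univ
        rw [Set.univ_prod_univ, setIntegral_univ] at h2
        rwa [ih, h2, zero_add] at h1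
      | iUnion f hd hm ih =>
        rw [integral_iUnion hm hd hint.integrableOn]
        simp [ih]
    have h0 := hint.ae_eq_zero_of_forall_setIntegral_eq_zero fun A hA _ => hall A hA
    exact (ae_restrict_iff' (hBm.prod hBm)).1 h0
  rw [Lp.eq_zero_iff_ae_eq_zero]
  filter_upwards [ae_all_iff.2 hloc] with x hx
  obtain ⟨n, hn⟩ := exists_nat_gt (max |x.1| |x.2|)
  have h1 := abs_lt.1 ((le_max_left _ _).trans_lt hn)
  have h2 := abs_lt.1 ((le_max_right _ _).trans_lt hn)
  exact hx n ⟨h1, h2⟩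

/-! ### Tensor bases from a nested family of subspaces -/

section Hilbert

open Filter Topology

variable {H : Type*} [NormedAddCommGroup H] [InnerProductSpace ℂ H]

lemma isClosed_of_hasOrthogonalProjection (U : Submodule ℂ H) [U.HasOrthogonalProjection] :
    IsClosed (U : Set H) := by
  rw [← U.orthogonal_orthogonal]
  exact Submodule.isClosed_orthogonal _

lemma starProjection_sub_mem {U V : Submodule ℂ H} [U.HasOrthogonalProjection]
    [V.HasOrthogonalProjection] (h : V ≤ U) (f : H) :
    U.starProjection f - V.starProjection f ∈ U ⊓ Vᗮ := by
  refine ⟨U.sub_mem (U.starProjection_apply_mem f) (h (V.starProjection_apply_mem f)), ?_⟩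
  have h1 : (V.starProjection ∘SL U.starProjection) f = V.starProjection f := by
    rw [Submodule.starProjection_comp_starProjection_of_le h]
  rw [← h1, ContinuousLinearMap.comp_apply]
  exact Submodule.sub_starProjection_mem_orthogonal _

variable [CompleteSpace H]

lemma tendsto_starProjection_self {ι : Type*} [Preorder ι] {U : ι → Submodule ℂ H}
    [∀ i, (U i).HasOrthogonalProjection] (hU : Monotone U)
    (h : ∀ f, (∀ i, f ∈ (U i)ᗮ) → f = 0) (f : H) :
    Tendsto (fun i => (U i).starProjection f) atTop (𝓝 f) := by
  refine Submodule.starProjection_tendsto_self U hU f (top_le_iff.2 ?_)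
  rw [Submodule.topologicalClosure_eq_top_iff, ← Submodule.iInf_orthogonal, Submodule.eq_bot_iff]
  intro g hg
  exact h g ((Submodule.mem_iInf _).1 hg)

/-- The orthogonal complements increase, and their projections converge to the identity. -/
lemma tendsto_starProjection_zero {ι : Type*} [Preorder ι] {U : ι → Submodule ℂ H}
    [∀ i, (U i).HasOrthogonalProjection] (hU : Antitone U)
    (h : ∀ f, (∀ i, f ∈ U i) → f = 0) (f : H) :
    Tendsto (fun i => (U i).starProjection f) atTop (𝓝 0) := by
  have h1 := tendsto_starProjection_self (U := fun i => (U i)ᗮ)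
    (fun i j hij => Submodule.orthogonal_le (hU hij))
    (fun g hg => h g fun i => by simpa using hg i) f
  simpa [Submodule.starProjection_orthogonal_val] using (tendsto_const_nhds (x := f)).sub h1

lemma mem_closure_span_of_total {V : Submodule ℂ H} (hV : IsClosed (V : Set H)) {v : ℕ → H}
    (hv : ∀ k, v k ∈ V) (htot : ∀ f ∈ V, (∀ k, ⟪v k, f⟫ = 0) → f = 0) {f : H} (hf : f ∈ V) :
    f ∈ (Submodule.span ℂ (Set.range v)).topologicalClosure := by
  set S := (Submodule.span ℂ (Set.range v)).topologicalClosure with hS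
  have hSV : S ≤ V := Submodule.topologicalClosure_minimal _
    (Submodule.span_le.2 (Set.range_subset_iff.2 hv)) hV
  have hvS : ∀ k, v k ∈ S := fun k =>
    Submodule.le_topologicalClosure _ (Submodule.subset_span ⟨k, rfl⟩)
  have h0 : f - S.starProjection f = 0 := by
    refine htot _ (V.sub_mem hf (hSV (S.starProjection_apply_mem f))) fun k => ?_
    exact (Submodule.mem_orthogonal _ _).1 (S.sub_starProjection_mem_orthogonal f) _ (hvS k)
  rw [sub_eq_zero.1 h0]
  exact S.starProjection_apply_mem f

/-- One argument at a time: with the other fixed, the vanishing set is the kernel of a continuous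
functional, so it contains the closed span of a total family. -/
lemma inner_tensor_eq_zero_of_total {K : Type*} [NormedAddCommGroup K] [InnerProductSpace ℂ K]
    (T : H →L[ℂ] H →L[ℂ] K) {V W : Submodule ℂ H} (hV : IsClosed (V : Set H))
    (hW : IsClosed (W : Set H)) {v w : ℕ → H} (hv : ∀ k, v k ∈ V) (hw : ∀ k, w k ∈ W)
    (hvt : ∀ f ∈ V, (∀ k, ⟪v k, f⟫ = 0) → f = 0) (hwt : ∀ f ∈ W, (∀ k, ⟪w k, f⟫ = 0) → f = 0)
    {h : K} (hh : ∀ k l, ⟪h, T (v k) (w l)⟫ = 0) {f g : H} (hf : f ∈ V) (hg : g ∈ W) :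
    ⟪h, T f g⟫ = 0 := by
  have h1 : ∀ l, ⟪h, T f (w l)⟫ = 0 := by
    intro l
    have hle : (Submodule.span ℂ (Set.range v)).topologicalClosure ≤
        LinearMap.ker ((innerSL ℂ h).comp (T.flip (w l))).toLinearMap := by
      refine Submodule.topologicalClosure_minimal _ (Submodule.span_le.2 ?_)
        (ContinuousLinearMap.isClosed_ker _)
      rintro _ ⟨k, rfl⟩
      simpa using hh k l
    simpa using hle (mem_closure_span_of_total hV hv hvt hf)
  have hle : (Submodule.span ℂ (Set.range w)).topologicalClosure ≤
      LinearMap.ker ((innerSL ℂ h).comp (T f)).toLinearMap := by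
    refine Submodule.topologicalClosure_minimal _ (Submodule.span_le.2 ?_)
      (ContinuousLinearMap.isClosed_ker _)
    rintro _ ⟨l, rfl⟩
    simpa using h1 l
  simpa using hle (mem_closure_span_of_total hW hw hwt hg)

end Hilbert

/-! ### Nested subspaces along the radii of a covering -/

lemma sum_Ico_int_sub {M : Type*} [AddCommGroup M] (F : ℤ → M) {m n : ℤ} (h : m ≤ n) :
    ∑ i ∈ Finset.Ico m n, (F i - F (i + 1)) = F m - F n := by
  induction n, h using Int.leInduction with
  | base => simp
  | succ n hmn ih =>
    have e : Finset.Ico m (n + 1) = insert n (Finset.Ico m n) := by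
      ext i; simp only [Finset.mem_Ico, Finset.mem_insert]; omega
    rw [e, Finset.sum_insert (by simp), ih]
    abel

/-- The radius `radius α j`, with the value at the irrelevant index `0` chosen such that the
indices `-1`, `0`, `1` have the same radius. -/
def radius' (α : ℝ) (j : ℤ) : ℝ := if j = 0 then 1 else radius α j

lemma radius'_of_ne_zero (α : ℝ) {j : ℤ} (hj : j ≠ 0) : radius' α j = radius α j := if_neg hj

lemma radius'_neg_one (α : ℝ) : radius' α (-1) = 1 := by simp [radius', radius]

lemma radius'_zero (α : ℝ) : radius' α 0 = 1 := if_pos rfl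

lemma radius'_one (α : ℝ) : radius' α 1 = 1 := by simp [radius', radius]

lemma IsLevel.radius'_eq {j : ℤ} (hj : IsLevel j) (α : ℝ) : radius' α j = radius α j :=
  radius'_of_ne_zero α (by rcases hj with h | h <;> omega)

lemma IsLevel.radius'_sub_one {j : ℤ} (hj : IsLevel j) (α : ℝ) :
    radius' α (j - 1) = radius α (j - 1) :=
  radius'_of_ne_zero α (by rcases hj with h | h <;> omega)

lemma isLevel_or_eq (j : ℤ) : IsLevel j ∨ j = 0 ∨ j = 1 := by
  unfold IsLevel; omega

namespace AlphaCovering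

variable {α : ℝ} {C : AlphaCovering α}

lemma mem_annulus_iff {j : ℤ} {q : ℤ × ℤ} : q ∈ C.annulus j ↔ IsLevel j ∧
    (q.1 ∈ Set.Icc (-(C.N j : ℤ)) (C.N j) ∧ q.2 ∈ Set.Icc (-(C.N j : ℤ)) (C.N j)) ∧
    (q.1 = -(C.N j : ℤ) ∨ q.1 = C.N j ∨ q.2 = C.N j ∨ q.2 = -(C.N j : ℤ)) := by
  unfold annulus annulusL annulusR annulusT annulusB
  simp only [Set.mem_union, Set.mem_ofPred_eq, Set.mem_Icc]
  refine and_congr_right fun hj => ?_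
  have := C.one_le_N j hj
  omega

variable {H : Type*} [NormedAddCommGroup H] [InnerProductSpace ℂ H]

/-- A nested family `E t` of subspaces, and for each interval `[s, t)` of the covering an
orthonormal basis of the orthogonal complement of `E t` in `E s`. -/
structure LocalBases (C : AlphaCovering α) (E : ℝ → Submodule ℂ H) (v : ℤ → ℤ → ℕ → H) :
    Prop where
  le : ∀ j, IsLevel j → ∀ n ∈ Set.Icc (-(C.N j : ℤ)) (C.N j), E (C.r j (n + 1)) ≤ E (C.r j n)
  orthonormal : ∀ j, IsLevel j → ∀ n ∈ Set.Icc (-(C.N j : ℤ)) (C.N j), Orthonormal ℂ (v j n)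
  mem : ∀ j, IsLevel j → ∀ n ∈ Set.Icc (-(C.N j : ℤ)) (C.N j), ∀ k,
    v j n k ∈ E (C.r j n) ⊓ (E (C.r j (n + 1)))ᗮ
  total : ∀ j, IsLevel j → ∀ n ∈ Set.Icc (-(C.N j : ℤ)) (C.N j),
    ∀ f ∈ E (C.r j n) ⊓ (E (C.r j (n + 1)))ᗮ, (∀ k, ⟪v j n k, f⟫ = 0) → f = 0

namespace LocalBases

variable {E : ℝ → Submodule ℂ H} {v : ℤ → ℤ → ℕ → H} (B : LocalBases C E v)
include B

lemma antitone_endpoints {j : ℤ} (hj : IsLevel j) {m n : ℤ} (hm : -(C.N j : ℤ) ≤ m)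
    (hmn : m ≤ n) (hn : n ≤ C.N j + 1) : E (C.r j n) ≤ E (C.r j m) := by
  induction n, hmn using Int.leInduction with
  | base => exact le_rfl
  | succ n h ih => exact (B.le j hj n ⟨by omega, by omega⟩).trans (ih (by omega))

lemma radius'_step {j : ℤ} (hj : IsLevel j) :
    E (radius' α j) ≤ E (radius' α (j - 1)) ∧ E (-radius' α (j - 1)) ≤ E (-radius' α j) := by
  have hN := C.one_le_N j hj
  rw [hj.radius'_eq, hj.radius'_sub_one]
  constructor
  · rw [← C.r_last j hj, ← C.r_penultimate j hj]
    exact B.le j hj _ ⟨by omega, le_rfl⟩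
  · rw [← C.r_first j hj, ← C.r_second j hj]
    exact B.le j hj _ ⟨le_rfl, by omega⟩

lemma antitone_radius' : Antitone fun j : ℤ => E (radius' α j) := by
  refine antitone_int_of_succ_le fun j => ?_
  rcases isLevel_or_eq (j + 1) with h | h | h
  · simpa using (B.radius'_step h).1
  · obtain rfl : j = -1 := by omega
    simp [radius'_neg_one, radius'_zero]
  · obtain rfl : j = 0 := by omega
    simp [radius'_one, radius'_zero]

lemma monotone_neg_radius' : Monotone fun j : ℤ => E (-radius' α j) := by
  refine monotone_int_of_le_succ fun j => ?_
  rcases isLevel_or_eq (j + 1) with h | h | h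
  · simpa using (B.radius'_step h).2
  · obtain rfl : j = -1 := by omega
    simp [radius'_neg_one, radius'_zero]
  · obtain rfl : j = 0 := by omega
    simp [radius'_one, radius'_zero]

lemma radius'_le_neg_radius' (j : ℤ) : E (radius' α j) ≤ E (-radius' α j) := by
  have hlevel : ∀ {j : ℤ}, IsLevel j → E (radius' α j) ≤ E (-radius' α j) := by
    intro j hj
    rw [hj.radius'_eq, ← C.r_first j hj, ← C.r_last j hj]
    exact B.antitone_endpoints hj le_rfl (by omega) le_rfl
  have h1 := hlevel (j := -1) (Or.inl le_rfl)
  rw [radius'_neg_one] at h1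
  rcases isLevel_or_eq j with h | rfl | rfl
  · exact hlevel h
  · rwa [radius'_zero]
  · rwa [radius'_one]

/-- The space of a later interval lies in E at the right endpoint of the earlier one, to which the
earlier space is orthogonal. -/
lemma inner_eq_zero_of_lt {j : ℤ} (hj : IsLevel j) {m n : ℤ} (hm : -(C.N j : ℤ) ≤ m)
    (hmn : m < n) (hn : n ≤ C.N j) (k l : ℕ) : ⟪v j m k, v j n l⟫ = 0 := by
  have h1 := (B.mem j hj m ⟨hm, by omega⟩ k).2
  have h2 := (B.mem j hj n ⟨by omega, hn⟩ l).1
  exact (Submodule.mem_orthogonal' _ _).1 h1 _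
    (B.antitone_endpoints hj (m := m + 1) (by omega) (by omega) (by omega) h2)

lemma inner_eq_zero_of_ne {j : ℤ} (hj : IsLevel j) {m n : ℤ}
    (hm : m ∈ Set.Icc (-(C.N j : ℤ)) (C.N j)) (hn : n ∈ Set.Icc (-(C.N j : ℤ)) (C.N j))
    (hmn : m ≠ n) (k l : ℕ) : ⟪v j m k, v j n l⟫ = 0 := by
  rcases lt_or_gt_of_ne hmn with h | h
  · exact B.inner_eq_zero_of_lt hj hm.1 h hn.2 k l
  · exact inner_eq_zero_symm.1 (B.inner_eq_zero_of_lt hj hn.1 h hm.2 l k)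

/-- An outermost interval of level j lies beyond ±R_{j-1}, while all intervals of level i ≤ j - 1
lie in A_{j-1}. Monotonicity of E along the radii turns this separation into orthogonality. -/
lemma inner_outer_eq_zero {i j : ℤ} (hi : IsLevel i) (hj : IsLevel j) (hij : i < j) {m n : ℤ}
    (hm : m = -(C.N j : ℤ) ∨ m = C.N j) (hn : n ∈ Set.Icc (-(C.N i : ℤ)) (C.N i)) (k l : ℕ) :
    ⟪v j m k, v i n l⟫ = 0 := by
  have hN := C.one_le_N j hj
  obtain ⟨h1, h2⟩ := B.mem i hi n hn l
  rcases hm with rfl | rfl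
  · have h3 := (B.mem j hj _ ⟨le_rfl, by omega⟩ k).2
    refine (Submodule.mem_orthogonal' _ _).1 h3 _ ?_
    have h4 := B.antitone_endpoints hi le_rfl hn.1 (by have := hn.2; omega) h1
    rw [C.r_first i hi, ← hi.radius'_eq] at h4
    rw [C.r_second j hj, ← hj.radius'_sub_one]
    exact B.monotone_neg_radius' (by omega : i ≤ j - 1) h4
  · have h3 := (B.mem j hj _ ⟨by omega, le_rfl⟩ k).1
    refine (Submodule.mem_orthogonal _ _).1 h2 _ ?_
    refine B.antitone_endpoints hi (n := C.N i + 1) (by have := hn.1; omega)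
      (by have := hn.2; omega) le_rfl ?_
    rw [C.r_penultimate j hj, ← hj.radius'_sub_one] at h3
    rw [C.r_last i hi, ← hi.radius'_eq]
    exact B.antitone_radius' (by omega : i ≤ j - 1) h3

variable {K : Type*} [NormedAddCommGroup K] [InnerProductSpace ℂ K] (T : H →L[ℂ] H →L[ℂ] K)

lemma orthonormal_tensor (hT : ∀ f g f' g', ⟪T f g, T f' g'⟫ = ⟪f, f'⟫ * ⟪g, g'⟫) :
    Orthonormal ℂ fun p : (Σ j : ℤ, C.annulus j) × (ℕ × ℕ) =>
      T (v p.1.1 p.1.2.1.1 p.2.1) (v p.1.1 p.1.2.1.2 p.2.2) := by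
  have cross : ∀ {i j : ℤ} (q : C.annulus i) (q' : C.annulus j) (k k' : ℕ × ℕ), i < j →
      ⟪T (v j q'.1.1 k'.1) (v j q'.1.2 k'.2), T (v i q.1.1 k.1) (v i q.1.2 k.2)⟫ = 0 := by
    rintro i j ⟨q, hq⟩ ⟨q', hq'⟩ k k' hij
    obtain ⟨hi, ⟨hq1, hq2⟩, -⟩ := mem_annulus_iff.1 hq
    obtain ⟨hj, -, hout⟩ := mem_annulus_iff.1 hq'
    rw [hT]
    -- A rectangle of the annulus has an outermost interval in at least one coordinate, and that
    -- factor vanishes.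
    by_cases h : q'.1 = -(C.N j : ℤ) ∨ q'.1 = C.N j
    · rw [B.inner_outer_eq_zero hi hj hij h hq1, zero_mul]
    · rw [B.inner_outer_eq_zero hi hj hij (by tauto) hq2, mul_zero]
  constructor
  · rintro ⟨⟨j, ⟨q, hq⟩⟩, k⟩
    obtain ⟨hj, ⟨hq1, hq2⟩, -⟩ := mem_annulus_iff.1 hq
    have h := hT (v j q.1 k.1) (v j q.2 k.2) (v j q.1 k.1) (v j q.2 k.2)
    rw [inner_self_eq_norm_sq_to_K, inner_self_eq_norm_sq_to_K, inner_self_eq_norm_sq_to_K,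
      (B.orthonormal j hj _ hq1).1, (B.orthonormal j hj _ hq2).1] at h
    have h2 : ‖T (v j q.1 k.1) (v j q.2 k.2)‖ ^ 2 = 1 := by
      simpa using (by exact_mod_cast h : ‖T (v j q.1 k.1) (v j q.2 k.2)‖ ^ 2 = 1 ^ 2 * 1 ^ 2)
    exact (pow_eq_one_iff_of_nonneg (norm_nonneg _) two_ne_zero).1 h2
  · rintro ⟨⟨i, q⟩, k⟩ ⟨⟨j, q'⟩, k'⟩ hne
    rcases lt_trichotomy i j with hij | rfl | hij
    · exact inner_eq_zero_symm.1 (cross q q' k k' hij)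
    · obtain ⟨⟨q1, q2⟩, hq⟩ := q
      obtain ⟨⟨q1', q2'⟩, hq'⟩ := q'
      obtain ⟨k1, k2⟩ := k
      obtain ⟨k1', k2'⟩ := k'
      obtain ⟨hi, ⟨hq1, hq2⟩, -⟩ := mem_annulus_iff.1 hq
      obtain ⟨-, ⟨hq1', hq2'⟩, -⟩ := mem_annulus_iff.1 hq'
      show ⟪T (v i q1 k1) (v i q2 k2), T (v i q1' k1') (v i q2' k2')⟫ = 0
      rw [hT]
      by_cases e1 : q1 = q1'
      · by_cases e2 : q2 = q2'
        · subst e1 e2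
          by_cases e3 : k1 = k1'
          · have e4 : k2 ≠ k2' := by rintro rfl; exact hne (by rw [e3])
            rw [(B.orthonormal i hi _ hq2).2 e4, mul_zero]
          · rw [(B.orthonormal i hi _ hq1).2 e3, zero_mul]
        · rw [B.inner_eq_zero_of_ne hi hq2 hq2' e2, mul_zero]
      · rw [B.inner_eq_zero_of_ne hi hq1 hq1' e1, zero_mul]
    · exact cross q' q k' k hij

variable [∀ t, (E t).HasOrthogonalProjection] [CompleteSpace H]

/-- The bilinear forms of the squares `A_j × A_j` do not depend on the level, if tested against
a vector that is orthogonal to the tensor system. -/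
lemma inner_square_step {h : K}
    (hh : ∀ (j : ℤ) (q : C.annulus j) (k : ℕ × ℕ), ⟪h, T (v j q.1.1 k.1) (v j q.1.2 k.2)⟫ = 0)
    (f g : H) {j : ℤ} (hj : IsLevel j) :
    ⟪h, T ((E (-radius' α j)).starProjection f - (E (radius' α j)).starProjection f)
        ((E (-radius' α j)).starProjection g - (E (radius' α j)).starProjection g)⟫ =
      ⟪h, T ((E (-radius' α (j - 1))).starProjection f - (E (radius' α (j - 1))).starProjection f)
        ((E (-radius' α (j - 1))).starProjection g -
          (E (radius' α (j - 1))).starProjection g)⟫ := by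
  have hN := C.one_le_N j hj
  -- The projections of the single intervals telescope: all of them add up to the projection of A_j,
  -- and those without the two outermost to that of A_{j-1}.
  set d : ℤ → H → H := fun n f =>
    (E (C.r j n)).starProjection f - (E (C.r j (n + 1))).starProjection f with hd
  have outer : ∀ f, (E (-radius' α j)).starProjection f - (E (radius' α j)).starProjection f =
      ∑ n ∈ Finset.Ico (-(C.N j : ℤ)) (C.N j + 1), d n f := fun f => by
    rw [sum_Ico_int_sub (fun n => (E (C.r j n)).starProjection f) (by omega)]
    simp only [C.r_first j hj, C.r_last j hj, hj.radius'_eq]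
  have inner : ∀ f, (E (-radius' α (j - 1))).starProjection f -
      (E (radius' α (j - 1))).starProjection f =
      ∑ n ∈ Finset.Ico (-(C.N j : ℤ) + 1) (C.N j), d n f := fun f => by
    rw [sum_Ico_int_sub (fun n => (E (C.r j n)).starProjection f) (by omega)]
    simp only [C.r_second j hj, C.r_penultimate j hj, hj.radius'_sub_one]
  -- A pair with a non-interior index is a rectangle of the annulus, where the orthogonality of h to
  -- the basis extends to the whole tensor product of the two spaces.
  have hzero : ∀ m ∈ Finset.Ico (-(C.N j : ℤ)) (C.N j + 1),
      ∀ n ∈ Finset.Ico (-(C.N j : ℤ)) (C.N j + 1),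
      (m ∉ Finset.Ico (-(C.N j : ℤ) + 1) (C.N j) ∨ n ∉ Finset.Ico (-(C.N j : ℤ) + 1) (C.N j)) →
      ⟪h, T (d m f) (d n g)⟫ = 0 := by
    intro m hm n hn hmn
    rw [Finset.mem_Ico] at hm hn hmn
    rw [Finset.mem_Ico] at hmn
    have hm' : m ∈ Set.Icc (-(C.N j : ℤ)) (C.N j) := ⟨hm.1, by omega⟩
    have hn' : n ∈ Set.Icc (-(C.N j : ℤ)) (C.N j) := ⟨hn.1, by omega⟩
    have hq : (m, n) ∈ C.annulus j :=
      mem_annulus_iff.2 ⟨hj, ⟨hm', hn'⟩, by simp only; omega⟩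
    have hc : ∀ n, IsClosed
        ((E (C.r j n) ⊓ (E (C.r j (n + 1)))ᗮ : Submodule ℂ H) : Set H) := fun n =>
      (isClosed_of_hasOrthogonalProjection _).inter (Submodule.isClosed_orthogonal _)
    exact inner_tensor_eq_zero_of_total T (hc m) (hc n) (B.mem j hj m hm') (B.mem j hj n hn')
      (B.total j hj m hm') (B.total j hj n hn') (fun k l => hh j ⟨_, hq⟩ (k, l))
      (starProjection_sub_mem (B.le j hj m hm') f) (starProjection_sub_mem (B.le j hj n hn') g)
  have hsub : Finset.Ico (-(C.N j : ℤ) + 1) (C.N j) ⊆ Finset.Ico (-(C.N j : ℤ)) (C.N j + 1) :=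
    Finset.Ico_subset_Ico (by omega) (by omega)
  rw [outer, outer, inner, inner]
  simp only [map_sum, _root_.sum_apply, inner_sum]
  symm
  rw [Finset.sum_subset hsub fun n hn hn' => Finset.sum_eq_zero fun m hm =>
    hzero m (hsub hm) n hn (Or.inr hn')]
  refine Finset.sum_congr rfl fun n hn => ?_
  exact Finset.sum_subset hsub fun m hm hm' => hzero m hm n hn (Or.inl hm')

-- The form of the square A_j is independent of j; its limits at +∞ and -∞ are ⟪h, T f g⟫ and 0.
open Filter Topology in
lemma eq_zero_of_inner_tensor_eq_zero
    (hT : ∀ h, (∀ f g, ⟪h, T f g⟫ = 0) → h = 0)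
    (htop : ∀ f, Tendsto (fun j : ℤ => (E (-radius' α j)).starProjection f -
      (E (radius' α j)).starProjection f) atTop (𝓝 f))
    (hbot : ∀ f, Tendsto (fun j : ℤ => (E (-radius' α j)).starProjection f -
      (E (radius' α j)).starProjection f) atBot (𝓝 0)) {h : K}
    (hh : ∀ (j : ℤ) (q : C.annulus j) (k : ℕ × ℕ), ⟪h, T (v j q.1.1 k.1) (v j q.1.2 k.2)⟫ = 0) :
    h = 0 := by
  refine hT h fun f g => ?_
  set c : ℤ → ℂ := fun j =>
    ⟪h, T ((E (-radius' α j)).starProjection f - (E (radius' α j)).starProjection f)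
        ((E (-radius' α j)).starProjection g - (E (radius' α j)).starProjection g)⟫ with hc
  have hstep : ∀ j, c (j + 1) = c j := by
    intro j
    rcases isLevel_or_eq (j + 1) with hj | hj | hj
    · simpa [hc] using B.inner_square_step T hh f g hj
    -- No annulus is crossed at levels 0 and 1, and none is needed: the radii of indices -1, 0, 1
    -- coincide.
    · obtain rfl : j = -1 := by omega
      simp [hc, radius'_neg_one, radius'_zero]
    · obtain rfl : j = 0 := by omega
      simp [hc, radius'_one, radius'_zero]
  have hconst : ∀ j, c j = c 0 := by
    intro j
    induction j using Int.induction_on with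
    | zero => rfl
    | succ i ih => rw [hstep, ih]
    | pred i ih => rw [← ih, ← hstep (-i - 1)]; congr 1; ring
  have hlim : ∀ {l : Filter ℤ} {F G : ℤ → H} {x y : H}, Tendsto F l (𝓝 x) → Tendsto G l (𝓝 y) →
      Tendsto (fun j => ⟪h, T (F j) (G j)⟫) l (𝓝 ⟪h, T x y⟫) := fun hF hG =>
    ((by fun_prop : Continuous fun p : H × H => ⟪h, T p.1 p.2⟫).tendsto _).comp
      (hF.prodMk_nhds hG)
  have h1 : Tendsto c atTop (𝓝 ⟪h, T f g⟫) := hlim (htop f) (htop g)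
  have h2 : Tendsto c atBot (𝓝 0) := by
    have h0 : ⟪h, T 0 0⟫ = 0 := by rw [map_zero, inner_zero_right]
    rw [← h0]
    exact hlim (hbot f) (hbot g)
  have e : c = fun _ => c 0 := funext hconst
  rw [e] at h1 h2
  rw [tendsto_nhds_unique h1 tendsto_const_nhds, tendsto_nhds_unique h2 tendsto_const_nhds]

end LocalBases

end AlphaCovering

open Filter Topology

/-! ### The local cosine bases of an `α`-covering -/

lemma tendsto_radius'_atTop {α : ℝ} (hα : α < 1) :
    Tendsto (fun n : ℕ => radius' α (n + 2)) atTop atTop := by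
  have hβ : 0 < 1 / (1 - α) := by have : 0 < 1 - α := by linarith
                                  positivity
  have h1 : Tendsto (fun n : ℕ => (n : ℝ) + 2) atTop atTop :=
    tendsto_atTop_add_const_right _ _ tendsto_natCast_atTop_atTop
  refine ((tendsto_rpow_atTop hβ).comp h1).congr fun n => ?_
  rw [radius'_of_ne_zero α (by omega), radius, if_pos (by omega)]
  simp

lemma tendsto_radius'_atBot {α : ℝ} (hα : α < 1) :
    Tendsto (fun n : ℕ => radius' α (-n - 1)) atTop (𝓝 0) := by
  have hβ : 0 < 1 / (1 - α) := by have : 0 < 1 - α := by linarith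
                                  positivity
  have h1 : Tendsto (fun n : ℕ => (n : ℝ) + 1) atTop atTop :=
    tendsto_atTop_add_const_right _ _ tendsto_natCast_atTop_atTop
  refine ((tendsto_rpow_neg_atTop hβ).comp h1).congr fun n => ?_
  rw [radius'_of_ne_zero α (by omega), radius, if_neg (by omega)]
  have : |((-n - 1 : ℤ) : ℝ)| = (n : ℝ) + 1 := by
    push_cast
    rw [abs_of_nonpos (by have : (0 : ℝ) ≤ n := n.cast_nonneg
                          linarith)]
    ring
  rw [this]
  rfl

namespace AlphaCovering

variable {α : ℝ} (C : AlphaCovering α)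

lemma admissible {j : ℤ} (hj : IsLevel j) {n : ℤ} (hn : n ∈ Set.Icc (-(C.N j : ℤ)) (C.N j)) :
    Admissible (C.r j n) (C.r j (n + 1)) (C.ε (C.r j n)) (C.ε (C.r j (n + 1))) where
  left_pos := C.ε_pos j hj n ⟨hn.1, by have := hn.2; omega⟩
  right_pos := C.ε_pos j hj (n + 1) ⟨by have := hn.1; omega, by have := hn.2; omega⟩
  add_le := C.ε_add_le j hj n hn

lemma admissible_right {j : ℤ} (hj : IsLevel j) :
    Admissible (radius' α (j - 1)) (radius' α j) (C.ε (radius' α (j - 1))) (C.ε (radius' α j)) := by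
  have h := C.admissible hj (n := C.N j) ⟨by omega, le_rfl⟩
  rwa [C.r_last j hj, C.r_penultimate j hj, ← hj.radius'_eq, ← hj.radius'_sub_one] at h

lemma admissible_left {j : ℤ} (hj : IsLevel j) :
    Admissible (-radius' α j) (-radius' α (j - 1)) (C.ε (-radius' α j))
      (C.ε (-radius' α (j - 1))) := by
  have h := C.admissible hj (n := -(C.N j : ℤ)) ⟨le_rfl, by omega⟩
  rwa [C.r_first j hj, C.r_second j hj, ← hj.radius'_eq, ← hj.radius'_sub_one] at h

/-- The subspace of the half-line with endpoint `t`, for the frequency variable `ξ / 2π`. -/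
def halfLine (ρ : ℝ → ℝ) (t : ℝ) : Submodule ℂ L2Line :=
  rightSpace ρ (t / (2 * Real.pi)) (C.ε t / (2 * Real.pi))

variable {ρ : ℝ → ℝ} (hρ : IsRamp ρ)

open Classical in
/-- The local cosine basis of the interval `I_{j,n}`, for the frequency variable `ξ / 2π`. -/
def localCosine (j n : ℤ) (k : ℕ) : L2Line :=
  if h : Admissible (C.r j n) (C.r j (n + 1)) (C.ε (C.r j n)) (C.ε (C.r j (n + 1))) then
    h.scale.lpHat hρ k
  else 0

lemma localBases : LocalBases C (C.halfLine ρ) (C.localCosine hρ) where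
  le j hj n hn := by
    have h := (C.admissible hj hn).scale
    exact hρ.rightSpace_le h.left_pos h.right_pos (by linarith [h.add_le])
  orthonormal j hj n hn := by
    have h := C.admissible hj hn
    have e : C.localCosine hρ j n = h.scale.lpHat hρ := funext fun k => dif_pos h
    rw [e]
    exact h.scale.orthonormal_lpHat hρ
  mem j hj n hn k := by
    have h := C.admissible hj hn
    rw [localCosine, dif_pos h, halfLine, halfLine, hρ.orthogonal_rightSpace]
    exact ⟨h.scale.lpHat_mem_rightSpace hρ k, h.scale.lpHat_mem_leftSpace hρ k⟩
  total j hj n hn f hf hk := by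
    have h := C.admissible hj hn
    rw [halfLine, halfLine, hρ.orthogonal_rightSpace] at hf
    refine h.scale.eq_zero_of_inner_lpHat_eq_zero hρ hf.1 hf.2 fun k => ?_
    have := hk k
    rwa [localCosine, dif_pos h] at this

include hρ

lemma hasOrthogonalProjection_halfLine (t : ℝ) : (C.halfLine ρ t).HasOrthogonalProjection :=
  hρ.hasOrthogonalProjection_rightSpace _ _

/-- The cutoff zone at b does not reach back to a. A neighbouring endpoint thus replaces any bound
on the radius at b itself. -/
lemma ae_eq_zero_of_mem_halfLine {a b : ℝ} (h : Admissible a b (C.ε a) (C.ε b)) {f : L2Line}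
    (hf : f ∈ C.halfLine ρ b) : ∀ᵐ ξ : ℝ, ξ ≤ a / (2 * Real.pi) → f ξ = 0 := by
  filter_upwards [hρ.ae_eq_zero_of_mem_rightSpace h.scale.right_pos hf] with ξ h1 h2
  exact h1 (by linarith [h.scale.add_le, h.scale.left_pos])

lemma ae_eq_zero_of_mem_orthogonal_halfLine {a b : ℝ} (h : Admissible a b (C.ε a) (C.ε b))
    {f : L2Line} (hf : f ∈ (C.halfLine ρ a)ᗮ) : ∀ᵐ ξ : ℝ, b / (2 * Real.pi) ≤ ξ → f ξ = 0 := by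
  rw [halfLine, hρ.orthogonal_rightSpace] at hf
  filter_upwards [hρ.ae_eq_zero_of_mem_leftSpace h.scale.left_pos hf] with ξ h1 h2
  exact h1 (by linarith [h.scale.add_le, h.scale.right_pos])

variable [∀ t, (C.halfLine ρ t).HasOrthogonalProjection]

/-- The two projections converge separately. A function orthogonal to all E(-R_j), or contained in
all E(R_j), vanishes on half-lines that exhaust ℝ. -/
lemma tendsto_square_atTop (hα : α < 1) (f : L2Line) :
    Tendsto (fun j : ℤ => (C.halfLine ρ (-radius' α j)).starProjection f -
      (C.halfLine ρ (radius' α j)).starProjection f) atTop (𝓝 f) := by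
  have B := C.localBases hρ
  have hlevel : ∀ n : ℕ, IsLevel (n + 2 + 1) := fun n => Or.inr (by omega)
  have hrad : ∀ x : ℝ, ∃ n : ℕ, x ≤ radius' α (n + 2) / (2 * Real.pi) := fun x => by
    obtain ⟨n, hn⟩ := ((tendsto_radius'_atTop hα).eventually_ge_atTop (x * (2 * Real.pi))).exists
    exact ⟨n, (le_div_iff₀ Real.two_pi_pos).2 hn⟩
  have h1 := tendsto_starProjection_self B.monotone_neg_radius' (fun g hg => by
    rw [Lp.eq_zero_iff_ae_eq_zero]
    have h2 : ∀ᵐ ξ : ℝ, ∀ n : ℕ, -radius' α (n + 2) / (2 * Real.pi) ≤ ξ → g ξ = 0 :=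
      ae_all_iff.2 fun n => by
        have h3 := C.ae_eq_zero_of_mem_orthogonal_halfLine hρ (C.admissible_left (hlevel n)) (hg _)
        simpa using h3
    filter_upwards [h2] with ξ h3
    obtain ⟨n, hn⟩ := hrad (-ξ)
    exact h3 n (by rw [neg_div]; linarith)) f
  have h2 := tendsto_starProjection_zero B.antitone_radius' (fun g hg => by
    rw [Lp.eq_zero_iff_ae_eq_zero]
    have h2 : ∀ᵐ ξ : ℝ, ∀ n : ℕ, ξ ≤ radius' α (n + 2) / (2 * Real.pi) → g ξ = 0 :=
      ae_all_iff.2 fun n => by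
        have h3 := C.ae_eq_zero_of_mem_halfLine hρ (C.admissible_right (hlevel n)) (hg _)
        simpa using h3
    filter_upwards [h2] with ξ h3
    obtain ⟨n, hn⟩ := hrad ξ
    exact h3 n hn) f
  simpa using h1.sub h2

/-- The two projections do not tend to 0 separately, but their difference projects onto spaces that
decrease as j → -∞. A function in all of them vanishes outside intervals shrinking to 0. -/
lemma tendsto_square_atBot (hα : α < 1) (f : L2Line) :
    Tendsto (fun j : ℤ => (C.halfLine ρ (-radius' α j)).starProjection f -
      (C.halfLine ρ (radius' α j)).starProjection f) atBot (𝓝 0) := by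
  have B := C.localBases hρ
  set V : ℤ → Submodule ℂ L2Line := fun j =>
    C.halfLine ρ (-radius' α (-j)) ⊓ (C.halfLine ρ (radius' α (-j)))ᗮ with hV
  have hproj : ∀ j, (V j).HasOrthogonalProjection := fun j => by
    have hc : IsClosed (V j : Set L2Line) :=
      (isClosed_of_hasOrthogonalProjection _).inter (Submodule.isClosed_orthogonal _)
    have := hc.completeSpace_coe
    infer_instance
  have hVanti : Antitone V := fun i j hij => inf_le_inf
    (B.monotone_neg_radius' (neg_le_neg hij))
    (Submodule.orthogonal_le (B.antitone_radius' (neg_le_neg hij)))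
  have heq : ∀ j : ℤ, (V j).starProjection f =
      (C.halfLine ρ (-radius' α (-j))).starProjection f -
      (C.halfLine ρ (radius' α (-j))).starProjection f := by
    intro j
    refine Submodule.eq_starProjection_of_mem_orthogonal
      (starProjection_sub_mem (B.radius'_le_neg_radius' (-j)) f) ?_
    -- The remainder is (f - P f) + Q f, with P, Q the two projections; the first term is orthogonal
    -- to the range of P, the second to the complement of the range of Q.
    rw [← sub_add]
    refine Submodule.add_mem _ ?_ ?_
    · exact Submodule.orthogonal_le inf_le_left
        (Submodule.sub_starProjection_mem_orthogonal f)
    · exact Submodule.orthogonal_le inf_le_right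
        (Submodule.le_orthogonal_orthogonal _ (Submodule.starProjection_apply_mem _ f))
  have hlevel : ∀ n : ℕ, IsLevel (-n - 1) := fun n => Or.inl (by omega)
  have h1 := tendsto_starProjection_zero hVanti (fun g hg => by
    rw [Lp.eq_zero_iff_ae_eq_zero]
    -- A function in the space of index -n - 2 vanishes outside A_{-n-1}: the outermost intervals of
    -- level -n - 1 absorb the cutoffs.
    have e : ∀ n : ℕ, -((n : ℤ) + 2) = -n - 1 - 1 := fun n => by ring
    have h2 : ∀ᵐ ξ : ℝ, ∀ n : ℕ, ξ ≤ -radius' α (-n - 1) / (2 * Real.pi) → g ξ = 0 :=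
      ae_all_iff.2 fun n => by
        have h3 := (hg (n + 2)).1
        rw [e] at h3
        exact C.ae_eq_zero_of_mem_halfLine hρ (C.admissible_left (hlevel n)) h3
    have h2' : ∀ᵐ ξ : ℝ, ∀ n : ℕ, radius' α (-n - 1) / (2 * Real.pi) ≤ ξ → g ξ = 0 :=
      ae_all_iff.2 fun n => by
        have h3 := (hg (n + 2)).2
        rw [e] at h3
        exact C.ae_eq_zero_of_mem_orthogonal_halfLine hρ (C.admissible_right (hlevel n)) h3
    have hne : ∀ᵐ ξ : ℝ, ξ ≠ 0 := by simp [ae_iff]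
    filter_upwards [h2, h2', hne] with ξ h3 h4 h5
    have h6 : 0 < |ξ| * (2 * Real.pi) := mul_pos (abs_pos.2 h5) Real.two_pi_pos
    obtain ⟨n, hn⟩ := ((tendsto_radius'_atBot hα).eventually_le_const h6).exists
    rw [← div_le_iff₀ Real.two_pi_pos] at hn
    rcases le_abs'.1 hn with h7 | h7
    · exact h3 n (by rwa [neg_div])
    · exact h4 n h7) f
  simp_rw [heq] at h1
  have h2 := h1.comp tendsto_neg_atBot_atTop
  simpa [Function.comp_def] using h2

end AlphaCovering

end Brushlet

end

/-! ### The orthonormal basis of the plane -/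

open Brushlet in
theorem mainTheorem2 (α : ℝ) (hα₀ : 0 ≤ α) (hα₁ : α < 1)
    (ρ : ℝ → ℝ) (hρ : Brushlet.IsRamp ρ) (C : Brushlet.AlphaCovering α) :
    ∃ w : HilbertBasis ((Σ j : ℤ, C.annulus j) × (ℕ × ℕ)) ℂ
        (MeasureTheory.Lp ℂ 2 (MeasureTheory.volume : MeasureTheory.Measure (ℝ × ℝ))),
      ∀ (j : ℤ) (q : C.annulus j) (k : ℕ × ℕ),
        ⇑(w (⟨j, q⟩, k)) =ᵐ[MeasureTheory.volume] C.bivariate ρ j q k := by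
  have : ∀ t, (C.halfLine ρ t).HasOrthogonalProjection := C.hasOrthogonalProjection_halfLine hρ
  have B := C.localBases hρ
  let Φ := (Lp.fourierTransformₗᵢ ℝ ℂ).symm
  -- Composing the tensor product with the inverse Fourier transform in each factor keeps inner
  -- products multiplicative, so the abstract argument runs on local cosines and yields brushlets.
  let T : L2Line →L[ℂ] L2Line →L[ℂ] L2Plane :=
    tensorCLM.bilinearComp (Φ : L2Line →L[ℂ] L2Line) (Φ : L2Line →L[ℂ] L2Line)
  have hT : ∀ f g, T f g = tensorLp (Φ f) (Φ g) := fun f g => rfl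
  have hon := B.orthonormal_tensor T (fun f g f' g' => by
    rw [hT, hT, inner_tensorLp, Φ.inner_map_map, Φ.inner_map_map])
  have htot : ∀ h, (∀ f g, inner ℂ h (T f g) = 0) → h = 0 := fun h hh =>
    eq_zero_of_inner_tensorLp_eq_zero fun f g => by
      have h1 := inner_eq_zero_symm.1 (hh (Φ.symm f) (Φ.symm g))
      rwa [hT, Φ.apply_symm_apply, Φ.apply_symm_apply] at h1
  refine ⟨HilbertBasis.mkOfOrthogonalEqBot hon ?_, fun j q k => ?_⟩
  · rw [Submodule.eq_bot_iff]
    intro h hh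
    refine B.eq_zero_of_inner_tensor_eq_zero T htot (C.tendsto_square_atTop hρ hα₁)
      (C.tendsto_square_atBot hρ hα₁) fun j q k => ?_
    exact (Submodule.mem_orthogonal' _ _).1 hh _ (Submodule.subset_span ⟨(⟨j, q⟩, k), rfl⟩)
  · rw [HilbertBasis.coe_mkOfOrthogonalEqBot]
    obtain ⟨hj, ⟨hq1, hq2⟩, -⟩ := AlphaCovering.mem_annulus_iff.1 q.2
    have h1 := C.admissible hj hq1
    have h2 := C.admissible hj hq2
    simp only [hT, AlphaCovering.localCosine, dif_pos h1, dif_pos h2]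
    filter_upwards [coeFn_tensorLp (Φ (h1.scale.lpHat hρ k.1)) (Φ (h2.scale.lpHat hρ k.2)),
      ae_fst (coeFn_fourierInv_lpHat hρ h1 k.1), ae_snd (coeFn_fourierInv_lpHat hρ h2 k.2)]
      with x e e1 e2
    rw [e, e1, e2]
    rfl
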